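/- **Setting.** Let $n,m,k\ge 1$ be integers and let $p=\beta/n\in[0,1]$. There are $n$ users and $m$ slots. Every user transmits a replica of its packet in every slot with probability $p$, independently over users and slots, so that a slot has degree $d$ with probability $\Omega_d=\binom nd p^d(1-p)^{n-d}$. The receiver decodes iteratively. The reduced degree of a slot is the number of unresolved users that transmitted in it. At each iteration, if some slot has reduced degree in $\{1,\dots,k\}$, then one of the slots with the smallest such reduced degree is chosen uniformly at random, one of the unresolved users present in it is chosen uniformly at random, and this user is resolved and removed from all slots; otherwise decoding ends. When $u$ users are unresolved, $c_u$ is the number of slots of reduced degree $>k$ (the cloud) and $r_u^{(h)}$, $1\le h\le k$, is the number of slots of reduced degree $h$ (the $h$-th ripple). The decoder state is $S_u=(c_u,r_u^{(k)},\dots,r_u^{(1)})$; the event $S_u=s$ includes that decoding reaches a stage with $u$ unresolved users. **Theorem.** Convention: $\binom ls=0$ if $s<0$ or $s>l$, a term with such a coefficient is $0$, $0^0=1$, and a quotient with denominator $0$ is $0$. (1) *Transition law.* Let $1\le u\le n$ and let $s=(c_u,r_u^{(k)},\dots,r_u^{(1)})$ satisfy $\sum_{i=1}^k r_u^{(i)}>0$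 and $\Pr\{S_u=s\}>0$. For all integers $b_u,a_u^{(1)},\dots,a_u^{(k)}$ such that $s+w$ has non-negative entries, where $w=(-b_u,\;b_u-a_u^{(k)},\;a_u^{(k)}-a_u^{(k-1)},\dots,a_u^{(2)}-a_u^{(1)})$, $$\Pr\{S_{u-1}=s+w\mid S_u=s\}=\binom{c_u}{b_u}q_u^{b_u}(1-q_u)^{c_u-b_u}\prod_{h=1}^k\binom{l^{(h)}}{s^{(h)}}\Big(\frac hu\Big)^{s^{(h)}}\Big(1-\frac hu\Big)^{l^{(h)}-s^{(h)}},$$ where $$q_u=\frac{\displaystyle\sum_{d=k+1}^n\Omega_d\,\frac dn\binom{d-1}k\frac{\binom{u-1}k}{\binom{n-1}k}\frac{\binom{n-u}{d-k-1}}{\binom{n-k-1}{d-k-1}}}{\displaystyle 1-\sum_{h=0}^k\sum_{d=h}^n\Omega_d\frac{\binom uh\binom{n-u}{d-h}}{\binom nd}},$$ and $(l^{(h)},s^{(h)})=(r_u^{(h)}-1,\;a_u^{(h)}-1)$ if $r_u^{(h)}>0$ and $\sum_{i<h}r_u^{(i)}=0$, and $(l^{(h)},s^{(h)})=(r_u^{(h)},a_u^{(h)})$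 otherwise. (2) *Initial state.* With $r_n=\sum_{i=1}^k r_n^{(i)}$, for $c_n+r_n\le m$, $$\Pr\{S_n=(c_n,r_n^{(k)},\dots,r_n^{(1)})\}=\frac{m!}{c_n!\,\prod_{h=1}^k r_n^{(h)}!\,(m-c_n-r_n)!}\Big(1-\sum_{i=0}^k\Omega_i\Big)^{c_n}\prod_{h=1}^k\Omega_h^{r_n^{(h)}}\;\Omega_0^{\,m-c_n-r_n},$$ and this probability is $0$ if $c_n+r_n>m$. (3) *Exact finite-length performance.* For every $u\le n$, the law of $S_u$ is the one computed by starting from (2) and applying the transition probabilities of (1) recursively to the states with a non-empty ripple. With these state probabilities, the probability that any given user is not resolved when decoding ends is $$P_e=\sum_{u=1}^n\sum_{c=0}^m\frac un\Pr\{S_u=(c,0,\dots,0)\},$$ and the expected throughput, i.e. the expected number of resolved users divided by $k\,m$, is $T=\dfrac{n(1-P_e)}{k\,m}$. -/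

import Mathlib

open MeasureTheory ProbabilityTheory

noncomputable section

namespace FramelessAloha

/-! ### Contention and decoding -/

/-- The bipartite graph of a contention period with `n` users and `m` slots: `G j v = true` means
that user `v` transmits a replica in slot `j`. -/
abbrev Graph (n m : ℕ) : Type := Fin m → Fin n → Bool

/-- The law of the graph: every user transmits in every slot with probability `p`, independently
over users and slots. -/
def graphLaw (n m : ℕ) (p : unitInterval) : PMF (Graph n m) :=
  (Measure.pi fun _ : Fin m => Measure.pi fun _ : Fin n => bernoulliMeasure true false p).toPMF

/-- The users that are still unresolved after the users in the list `L` have been resolved. -/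
def unresolved {n : ℕ} (L : List (Fin n)) : Finset (Fin n) :=
  Finset.univ.filter fun v => v ∉ L

/-- The packets still present in slot `j` when `U` is the set of unresolved users. -/
def present {n m : ℕ} (G : Graph n m) (U : Finset (Fin n)) (j : Fin m) : Finset (Fin n) :=
  U.filter fun v => G j v = true

/-- The reduced degree of slot `j` when `U` is the set of unresolved users. -/
def redDeg {n m : ℕ} (G : Graph n m) (U : Finset (Fin n)) (j : Fin m) : ℕ :=
  (present G U j).card

/-- The `h`-th ripple: the slots of reduced degree `h`. -/
def ripple {n m : ℕ} (G : Graph n m) (U : Finset (Fin n)) (h : ℕ) : Finset (Fin m) :=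
  Finset.univ.filter fun j => redDeg G U j = h

/-- The cloud: the slots of reduced degree larger than `k`. -/
def cloud {n m : ℕ} (k : ℕ) (G : Graph n m) (U : Finset (Fin n)) : Finset (Fin m) :=
  Finset.univ.filter fun j => k < redDeg G U j

/-- The slots that `k`-multi-user detection can decode: reduced degree between `1` and `k`. -/
def decodable {n m : ℕ} (k : ℕ) (G : Graph n m) (U : Finset (Fin n)) : Finset (Fin m) :=
  Finset.univ.filter fun j => 1 ≤ redDeg G U j ∧ redDeg G U j ≤ k

/-- The decodable slots of minimum reduced degree. -/
def lowest {n m : ℕ} (k : ℕ) (G : Graph n m) (U : Finset (Fin n)) : Finset (Fin m) :=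
  (decodable k G U).filter fun j => ∀ i ∈ decodable k G U, redDeg G U j ≤ redDeg G U i

theorem present_nonempty {n m k : ℕ} {G : Graph n m} {U : Finset (Fin n)} {j : Fin m}
    (hj : j ∈ lowest k G U) : (present G U j).Nonempty := by
  have h : 1 ≤ redDeg G U j := by
    have h1 := (Finset.mem_filter.mp hj).1
    exact (Finset.mem_filter.mp h1).2.1
  exact Finset.card_pos.mp h

/-- One iteration of the decoder, acting on the list of the users resolved so far, in the order of
their resolution. If no slot is decodable, nothing changes any more. Otherwise one of the decodable
slots of minimum reduced degree is chosen uniformly at random, then one of the users still present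
in it is chosen uniformly at random, and this user is resolved. -/
def step {n m : ℕ} (k : ℕ) (G : Graph n m) (L : List (Fin n)) : PMF (List (Fin n)) :=
  if hne : (lowest k G (unresolved L)).Nonempty then
    (PMF.uniformOfFinset (lowest k G (unresolved L)) hne).bindOnSupport fun j hj =>
      (PMF.uniformOfFinset (present G (unresolved L) j)
        (present_nonempty ((PMF.mem_support_uniformOfFinset_iff hne j).mp hj))).map
        fun v => L ++ [v]
  else PMF.pure L

/-- The list of resolved users after a number of decoder iterations. -/
def decode {n m : ℕ} (k : ℕ) (G : Graph n m) : ℕ → PMF (List (Fin n))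
  | 0 => PMF.pure []
  | t + 1 => (decode k G t).bind (step k G)

/-- A complete run: the graph and the list of all users resolved when the decoding process ends,
in the order of their resolution. -/
structure Outcome (n m : ℕ) where
  graph : Graph n m
  resolved : List (Fin n)

instance (n m : ℕ) : MeasurableSpace (Outcome n m) := ⊤

/-- The probability measure that governs a complete run. The process ends after at most `n`
iterations, as each of them resolves one of the `n` users or leaves everything unchanged. -/
def runLaw (n m k : ℕ) (p : unitInterval) : Measure (Outcome n m) :=
  ((graphLaw n m p).bind fun G => (decode k G n).map fun L => Outcome.mk G L).toMeasure

/-- A decoder state `(c, r)`: the cardinality `c` of the cloud, and the cardinalities of the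
ripples, `r i` being that of the `(i + 1)`-th ripple for `i = 0, …, k - 1`. -/
abbrev State (k : ℕ) : Type := ℕ × (Fin k → ℕ)

/-- The decoder state when `U` is the set of unresolved users. -/
def stateOf {n m : ℕ} (k : ℕ) (G : Graph n m) (U : Finset (Fin n)) : State k :=
  ((cloud k G U).card, fun i => (ripple G U (i.val + 1)).card)

/-- The random variable `S_u`: the decoder state when `u` users are unresolved; it is `none` if
the decoding process ends before only `u` users are left unresolved. -/
def stateAt {n m : ℕ} (k u : ℕ) (ω : Outcome n m) : Option (State k) :=
  if u ≤ n ∧ n - u ≤ ω.resolved.length then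
    some (stateOf k ω.graph (unresolved (ω.resolved.take (n - u))))
  else none

/-- The packet error rate of user `v`: the probability that `v` is not resolved when the decoding
process ends. -/
def packetErrorRate (n m k : ℕ) (p : unitInterval) (v : Fin n) : ℝ :=
  (runLaw n m k p).real {ω | v ∉ ω.resolved}

/-- The expected throughput: the expected number of resolved users, normalized by `k` and by the
number of slots. -/
def throughput (n m k : ℕ) (p : unitInterval) : ℝ :=
  (∫ ω, (ω.resolved.toFinset.card : ℝ) ∂(runLaw n m k p)) / ((k : ℝ) * (m : ℝ))

/-! ### The closed-form expressions -/

/-- `Ω_d`, the probability that a slot has degree `d`. -/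
def slotDegreeProb (n : ℕ) (p : ℝ) (d : ℕ) : ℝ :=
  (n.choose d : ℝ) * p ^ d * (1 - p) ^ (n - d)

/-- `q_u`. -/
def cloudExitProb (n k : ℕ) (p : ℝ) (u : ℕ) : ℝ :=
  (∑ d ∈ Finset.Icc (k + 1) n,
      slotDegreeProb n p d * ((d : ℝ) / n) * ((d - 1).choose k : ℝ) *
        (((u - 1).choose k : ℝ) / ((n - 1).choose k : ℝ)) *
        (((n - u).choose (d - k - 1) : ℝ) / ((n - k - 1).choose (d - k - 1) : ℝ))) /
    (1 - ∑ h ∈ Finset.Icc 0 k, ∑ d ∈ Finset.Icc h n,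
      slotDegreeProb n p d * (((u.choose h : ℝ) * ((n - u).choose (d - h) : ℝ)) /
        (n.choose d : ℝ)))

/-- The binomial probability of `s` successes in `l` trials with success probability `q`. The
binomial coefficient, hence the probability, is `0` if `s < 0` or `s > l`. -/
def binomialTerm (l : ℕ) (q : ℝ) (s : ℤ) : ℝ :=
  if 0 ≤ s then (l.choose s.toNat : ℝ) * q ^ s.toNat * (1 - q) ^ (l - s.toNat) else 0

/-- The `(i + 1)`-th ripple is the lowest non-empty one. -/
abbrev IsLowestRipple {k : ℕ} (r : Fin k → ℕ) (i : Fin k) : Prop :=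
  0 < r i ∧ ∑ j ∈ Finset.univ.filter (fun j => j < i), r j = 0

/-- `l^(h)`, with `h = i + 1`. -/
def trials {k : ℕ} (r : Fin k → ℕ) (i : Fin k) : ℕ :=
  if IsLowestRipple r i then r i - 1 else r i

/-- `s^(h)`, with `h = i + 1`. -/
def successes {k : ℕ} (r : Fin k → ℕ) (a : Fin k → ℤ) (i : Fin k) : ℤ :=
  if IsLowestRipple r i then a i - 1 else a i

/-- The number of slots entering the `(i + 1)`-th ripple, when `b` slots leave the cloud and `a i`
slots leave the `(i + 1)`-th ripple for each `i`: it is `a (i + 1)`, and `b` for the `k`-th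
ripple. -/
def inflow {k : ℕ} (b : ℤ) (a : Fin k → ℤ) (i : Fin k) : ℤ :=
  if h : i.val + 1 < k then a ⟨i.val + 1, h⟩ else b

/-- The probability that, in the transition from `u` to `u - 1` unresolved users out of the state
`s`, `b` slots leave the cloud and `a i` slots leave the `(i + 1)`-th ripple for each `i`. -/
def transitionProb (n k : ℕ) (p : ℝ) (u : ℕ) (s : State k) (b : ℤ) (a : Fin k → ℤ) : ℝ :=
  binomialTerm s.1 (cloudExitProb n k p u) b *
    ∏ i : Fin k, binomialTerm (trials s.2 i) (((i.val + 1 : ℕ) : ℝ) / (u : ℝ))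
      (successes s.2 a i)

/-- The multinomial law of the initial state. -/
def initialProb (n m k : ℕ) (p : ℝ) (s : State k) : ℝ :=
  if s.1 + ∑ i, s.2 i ≤ m then
    (m.factorial : ℝ) /
        ((s.1.factorial : ℝ) * (∏ i, ((s.2 i).factorial : ℝ)) *
          ((m - s.1 - ∑ i, s.2 i).factorial : ℝ)) *
      (1 - ∑ h ∈ Finset.Icc 0 k, slotDegreeProb n p h) ^ s.1 *
      (∏ i : Fin k, slotDegreeProb n p (i.val + 1) ^ s.2 i) *
      slotDegreeProb n p 0 ^ (m - s.1 - ∑ i, s.2 i)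
  else 0

/-- The finitely many states with all cardinalities at most `m`. -/
def states (m k : ℕ) : Finset (State k) :=
  Finset.range (m + 1) ×ˢ Fintype.piFinset fun _ : Fin k => Finset.range (m + 1)

/-- The number of slots leaving the `(i + 1)`-th ripple in a transition from `s` to `s'`: the
number of slots lost by the cloud and all the ripples from the `(i + 1)`-th up. -/
def leaving {k : ℕ} (s s' : State k) (i : Fin k) : ℤ :=
  ((s.1 : ℤ) - s'.1) + ∑ j ∈ Finset.univ.filter (fun j => i ≤ j), ((s.2 j : ℤ) - s'.2 j)

/-- The recursion for the state probabilities, by the number `t = n - u` of resolved users: start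
from the multinomial law, and apply the transition law to every state that has a non-empty
ripple. -/
def stateProbAux (n m k : ℕ) (p : ℝ) : ℕ → State k → ℝ
  | 0, s => initialProb n m k p s
  | t + 1, s' =>
      ∑ s ∈ (states m k).filter (fun s => 0 < ∑ i, s.2 i),
        stateProbAux n m k p t s *
          transitionProb n k p (n - t) s ((s.1 : ℤ) - s'.1) (leaving s s')

/-- The probability, computed by the recursion, of the state `s` when `u` users are unresolved. -/
def stateProb (n m k : ℕ) (p : ℝ) (u : ℕ) (s : State k) : ℝ :=
  stateProbAux n m k p (n - u) s

/-- The packet error rate, computed from the recursion: decoding ends with `u` unresolved users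
when all the ripples are empty. -/
def packetErrorFormula (n m k : ℕ) (p : ℝ) : ℝ :=
  ∑ u ∈ Finset.Icc 1 n, ∑ c ∈ Finset.range (m + 1),
    ((u : ℝ) / n) * stateProb n m k p u (c, fun _ => 0)

end FramelessAloha

end

/-!
Run the decoder together with the random graph. The probability that the decoder has resolved the
users in the list `L`, in this order, depends on a slot only through what the decoder has seen of it
(`slotInfo`, `prefixProb_congr`): nothing as long as the slot is in the cloud, and otherwise its
resolved users and its reduced degree. Hence, given the past, the slots are still independent; a
slot of reduced degree `h ≤ k` is equally likely to contain any `h` of the `u` unresolved users, and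
a slot in the cloud follows its original law conditioned on a reduced degree larger than `k`. When
user `v` is resolved, a slot of the `h`-th ripple therefore leaves its ripple with probability
`h / u`, and a slot of the cloud leaves the cloud with probability `q_u` (`sum_slotWeight_leaves`),
so that the numbers of slots that leave the cloud and the ripples are independent and binomial
(`sum_graphWeight_leaveCard`).

The user `v` is the next one to be resolved with probability `a / (r h)`, where `h` is the index of
the lowest ripple, `r` its cardinality and `a` the number of its slots that contain `v`
(`resolveProb_eq`). Since `(a / (r h)) (r choose a) (h / u) ^ a` equals
`(1 / u) (r - 1 choose a - 1) (h / u) ^ (a - 1)` (`mul_binomial_eq`), this factor takes one trial and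
one success out of the binomial law of the lowest ripple. The remaining factor `1 / u` shows that `v`
is uniform among the unresolved users, independently of the states. The numbers of leaving slots and
the old state determine the new state, and conversely, which gives the joint law of two consecutive
states along any order of resolution (`sum_prefixProb_append`).

Summing over the orders of resolution gives the transition law and the recursion
(`sum_prefixStateProb_eq`), which starts from the multinomial law
(`sum_graphWeight_stateOf_univ`). Decoding ends with `u` unresolved users exactly when the state at
`u` has empty ripples, and by the uniformity of the resolved users a given user is then among the
unresolved ones with probability `u / n` (`sum_prefixStateProb_notMem`); this is the packet error
rate. The throughput is the sum over the users of the probabilities of being resolved.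
-/

namespace FramelessAloha

variable {n m k : ℕ}

/-! ### The decoding process -/

theorem mem_unresolved {L : List (Fin n)} {v : Fin n} : v ∈ unresolved L ↔ v ∉ L := by
  simp [unresolved]

theorem unresolved_append (L : List (Fin n)) (v : Fin n) :
    unresolved (L ++ [v]) = (unresolved L).erase v := by
  ext x
  simp [mem_unresolved, not_or, and_comm]

theorem card_unresolved {L : List (Fin n)} (hL : L.Nodup) :
    (unresolved L).card = n - L.length := by
  have h : unresolved L = L.toFinsetᶜ := by ext; simp [mem_unresolved]
  rw [h, Finset.card_compl, List.toFinset_card_of_nodup hL, Fintype.card_fin]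

theorem lowest_eq_empty_iff {G : Graph n m} {U : Finset (Fin n)} :
    lowest k G U = ∅ ↔ decodable k G U = ∅ := by
  constructor
  · intro h
    by_contra hne
    obtain ⟨j, hj, hmin⟩ := Finset.exists_min_image (decodable k G U) (redDeg G U)
      (Finset.nonempty_iff_ne_empty.mpr hne)
    have : j ∈ lowest k G U := Finset.mem_filter.mpr ⟨hj, hmin⟩
    simp [h] at this
  · intro h
    simp [lowest, h]

/-- The probability weight of one slot: every user is present with probability `p`. -/
noncomputable def slotWeight (p : ℝ) (x : Fin n → Bool) : ℝ := ∏ v, if x v then p else 1 - p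

/-- The probability weight of a graph, whose slots are independent. -/
noncomputable def graphWeight (p : ℝ) (G : Graph n m) : ℝ := ∏ j, slotWeight p (G j)

theorem graphLaw_toReal (p : unitInterval) (G : Graph n m) :
    (graphLaw n m p G).toReal = graphWeight p G := by
  rw [graphLaw, Measure.toPMF_apply, Measure.pi_singleton, ENNReal.toReal_prod]
  refine Finset.prod_congr rfl fun j _ => ?_
  rw [Measure.pi_singleton, ENNReal.toReal_prod]
  refine Finset.prod_congr rfl fun v _ => ?_
  change (bernoulliMeasure true false p).real {G j v} = _
  rw [bernoulliMeasure_real_apply p (measurableSet_singleton _)]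
  cases G j v <;> simp

/-- The probability that the next iteration resolves user `v` when `U` is the set of unresolved
users. -/
noncomputable def resolveProb (k : ℕ) (G : Graph n m) (U : Finset (Fin n)) (v : Fin n) : ℝ :=
  ∑ j ∈ lowest k G U,
    if v ∈ present G U j then ((lowest k G U).card : ℝ)⁻¹ * (redDeg G U j : ℝ)⁻¹ else 0

theorem step_of_lowest_eq_empty {G : Graph n m} {L : List (Fin n)}
    (h : lowest k G (unresolved L) = ∅) : step k G L = PMF.pure L := by
  rw [step, dif_neg (by simp [h])]

theorem step_append (G : Graph n m) (L : List (Fin n)) (v : Fin n) :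
    (step k G L (L ++ [v])).toReal = resolveProb k G (unresolved L) v := by
  by_cases hne : (lowest k G (unresolved L)).Nonempty
  · rw [step, dif_pos hne, PMF.bindOnSupport_apply, tsum_fintype,
      ENNReal.toReal_sum (fun j _ => ENNReal.mul_ne_top (PMF.apply_ne_top _ _)
        (by split_ifs; exacts [ENNReal.zero_ne_top, PMF.apply_ne_top _ _])),
      resolveProb, ← Finset.sum_subset (Finset.subset_univ (lowest k G (unresolved L)))]
    · refine Finset.sum_congr rfl fun j hj => ?_
      have h0 : ¬ PMF.uniformOfFinset (lowest k G (unresolved L)) hne j = 0 :=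
        (PMF.mem_support_uniformOfFinset_iff hne j).mpr hj
      rw [dif_neg h0, ENNReal.toReal_mul, PMF.uniformOfFinset_apply_of_mem hne hj, PMF.map_apply,
        tsum_eq_single v (fun w hw => by simp [Ne.symm hw]), if_pos rfl,
        PMF.uniformOfFinset_apply]
      split_ifs <;> simp [redDeg]
    · intro j _ hj
      rw [dif_pos (PMF.uniformOfFinset_apply_of_notMem hne hj), mul_zero, ENNReal.toReal_zero]
  · rw [Finset.not_nonempty_iff_eq_empty] at hne
    rw [step_of_lowest_eq_empty hne, PMF.pure_apply_of_ne _ _ (by simp), resolveProb, hne]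
    simp

theorem mem_support_step {G : Graph n m} {L L' : List (Fin n)}
    (h : L' ∈ (step k G L).support) (hne : (lowest k G (unresolved L)).Nonempty) :
    ∃ v ∈ unresolved L, L' = L ++ [v] := by
  rw [step, dif_pos hne, PMF.mem_support_bindOnSupport_iff] at h
  obtain ⟨j, _, h⟩ := h
  rw [PMF.mem_support_map_iff] at h
  obtain ⟨v, hv, rfl⟩ := h
  rw [PMF.mem_support_uniformOfFinset_iff] at hv
  exact ⟨v, (Finset.mem_filter.mp hv).1, rfl⟩

/-- The lists that the decoder can reach are free of repetitions, and one that is shorter than the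
number of iterations is final. -/
theorem mem_support_decode {G : Graph n m} {t : ℕ} {L : List (Fin n)}
    (h : L ∈ (decode k G t).support) :
    L.Nodup ∧ L.length ≤ t ∧ (L.length < t → lowest k G (unresolved L) = ∅) := by
  induction t generalizing L with
  | zero =>
    obtain rfl : L = [] := by simpa [decode] using h
    simp
  | succ t ih =>
    rw [decode, PMF.mem_support_bind_iff] at h
    obtain ⟨L', hL', h⟩ := h
    obtain ⟨hnd, hlen, hfin⟩ := ih hL'
    rcases (lowest k G (unresolved L')).eq_empty_or_nonempty with he | hne
    · rw [step_of_lowest_eq_empty he, PMF.mem_support_pure_iff] at h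
      subst h
      exact ⟨hnd, by omega, fun _ => he⟩
    · obtain ⟨v, hv, rfl⟩ := mem_support_step h hne
      have hlen' : L'.length = t := by
        by_contra hlt
        exact hne.ne_empty (hfin (by omega))
      refine ⟨?_, by simp [hlen'], fun hlt => ?_⟩
      · rw [List.nodup_append]
        refine ⟨hnd, by simp, ?_⟩
        rintro a ha b hb rfl
        rw [List.mem_singleton] at hb
        subst hb
        exact mem_unresolved.mp hv ha
      · simp [hlen'] at hlt

/-- The probability, given the graph, that the first users to be resolved are those in `L`, in this
order. -/
noncomputable def prefixProb (k : ℕ) (G : Graph n m) (L : List (Fin n)) : ℝ :=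
  (decode k G L.length L).toReal

theorem prefixProb_nil (G : Graph n m) : prefixProb k G [] = 1 := by
  simp [prefixProb, decode]

theorem prefixProb_append (G : Graph n m) (L : List (Fin n)) (v : Fin n) :
    prefixProb k G (L ++ [v]) = prefixProb k G L * resolveProb k G (unresolved L) v := by
  have hlen : (L ++ [v]).length = L.length + 1 := by simp
  -- after `L.length` iterations, `L` is the only list from which the next one leads to `L ++ [v]`
  rw [prefixProb, hlen, decode, PMF.bind_apply, tsum_eq_single L, ENNReal.toReal_mul, step_append,
    prefixProb]
  intro L' hL'
  by_contra hne
  obtain ⟨h1, h2⟩ := mul_ne_zero_iff.mp hne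
  rcases (lowest k G (unresolved L')).eq_empty_or_nonempty with he | hl
  · rw [step_of_lowest_eq_empty he] at h2
    have : L ++ [v] = L' := by simpa using (PMF.mem_support_iff _ _).mpr h2
    have h3 := (mem_support_decode ((PMF.mem_support_iff _ _).mpr h1)).2.1
    rw [← this] at h3
    simp at h3
  · obtain ⟨w, _, hw⟩ := mem_support_step ((PMF.mem_support_iff _ _).mpr h2) hl
    exact hL' (List.append_inj_left' hw rfl).symm

/-- The law of the prefix of length `t` of the resolved users does not change after `t`
iterations. -/
theorem map_prefix_decode (G : Graph n m) {t T : ℕ} (h : t ≤ T) :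
    (decode k G T).map (fun L => if t ≤ L.length then some (L.take t) else none) =
      (decode k G t).map (fun L => if t ≤ L.length then some (L.take t) else none) := by
  induction T, h using Nat.le_induction with
  | base => rfl
  | succ T hT ih =>
    rw [← ih, decode, PMF.map_bind]
    refine PMF.ext fun x => ?_
    rw [PMF.bind_apply, PMF.map_apply]
    refine tsum_congr fun L => ?_
    by_cases hL : decode k G T L = 0
    · simp [hL]
    obtain ⟨_, _, hfin⟩ := mem_support_decode ((PMF.mem_support_iff _ _).mpr hL)
    -- a further iteration leaves the prefix unchanged: it appends a user to a list of length at least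
    -- `t`, or the list is already final
    have key : (step k G L).map (fun L => if t ≤ L.length then some (L.take t) else none) =
        PMF.pure (if t ≤ L.length then some (L.take t) else none) := by
      rcases (lowest k G (unresolved L)).eq_empty_or_nonempty with he | hne
      · rw [step_of_lowest_eq_empty he, PMF.pure_map]
      · have hlen : t ≤ L.length := by
          by_contra hlt
          exact hne.ne_empty (hfin (by omega))
        rw [if_pos hlen]
        rw [← PMF.map_const (step k G L) (some (L.take t)), PMF.map, PMF.map]
        refine PMF.ext fun y => ?_
        rw [PMF.bind_apply, PMF.bind_apply]
        refine tsum_congr fun L' => ?_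
        by_cases hL' : step k G L L' = 0
        · simp [hL']
        obtain ⟨v, _, rfl⟩ := mem_support_step ((PMF.mem_support_iff _ _).mpr hL') hne
        have h1 : t ≤ (L ++ [v]).length := by simp; omega
        simp only [Function.comp, if_pos h1, List.take_append_of_le_length hlen,
          Function.const_apply]
    rw [key, PMF.pure_apply]
    split_ifs <;> simp

/-- The sequences of `t` distinct users. -/
def orders (n : ℕ) : ℕ → Finset (List (Fin n))
  | 0 => {[]}
  | t + 1 => (orders n t).biUnion fun L => (unresolved L).image fun v => L ++ [v]

theorem mem_orders {t : ℕ} {L : List (Fin n)} : L ∈ orders n t ↔ L.Nodup ∧ L.length = t := by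
  induction t generalizing L with
  | zero =>
    simp only [orders, Finset.mem_singleton, List.length_eq_zero_iff]
    exact ⟨fun h => by simp [h], fun h => h.2⟩
  | succ t ih =>
    simp only [orders, Finset.mem_biUnion, Finset.mem_image, ih]
    constructor
    · rintro ⟨L', ⟨hnd, rfl⟩, v, hv, rfl⟩
      refine ⟨?_, by simp⟩
      rw [List.nodup_append]
      refine ⟨hnd, by simp, ?_⟩
      rintro a ha b hb rfl
      rw [List.mem_singleton] at hb
      subst hb
      exact mem_unresolved.mp hv ha
    · rintro ⟨hnd, hlen⟩
      rcases List.eq_nil_or_concat L with rfl | ⟨L', v, rfl⟩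
      · simp at hlen
      · rw [List.concat_eq_append] at hnd hlen ⊢
        rw [List.nodup_append] at hnd
        refine ⟨L', ⟨hnd.1, by simpa using hlen⟩, v, ?_, rfl⟩
        rw [mem_unresolved]
        exact fun hv => hnd.2.2 v hv v (by simp) rfl

theorem sum_orders_succ {M : Type*} [AddCommMonoid M] (t : ℕ) (f : List (Fin n) → M) :
    ∑ L ∈ orders n (t + 1), f L = ∑ L ∈ orders n t, ∑ v ∈ unresolved L, f (L ++ [v]) := by
  rw [orders, Finset.sum_biUnion]
  · refine Finset.sum_congr rfl fun L _ => Finset.sum_image fun v _ w _ h => ?_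
    simpa using h
  · intro L _ L' _ hne
    rw [Function.onFun, Finset.disjoint_left]
    intro x hx hx'
    obtain ⟨v, _, rfl⟩ := Finset.mem_image.mp hx
    obtain ⟨w, _, hw⟩ := Finset.mem_image.mp hx'
    exact hne (List.append_inj_left' hw rfl).symm

theorem toOuterMeasure_toReal_eq_sum {α : Type*} (P : PMF α) (S : Finset α) (E : Set α)
    [DecidablePred (· ∈ E)] (hS : ∀ x ∈ P.support, x ∈ E → x ∈ S) :
    (P.toOuterMeasure E).toReal = ∑ x ∈ S, if x ∈ E then (P x).toReal else 0 := by
  rw [PMF.toOuterMeasure_apply, tsum_eq_sum (s := S), ENNReal.toReal_sum]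
  · refine Finset.sum_congr rfl fun x _ => ?_
    rw [Set.indicator_apply]
    split_ifs <;> simp
  · intro x _
    rw [Set.indicator_apply]
    split_ifs
    exacts [P.apply_ne_top x, ENNReal.zero_ne_top]
  · intro x hx
    rw [Set.indicator_apply, ite_eq_right_iff]
    intro hE
    by_contra h
    exact hx (hS x h hE)

theorem runLaw_real (p : unitInterval) (E : Set (Outcome n m)) :
    (runLaw n m k p).real E =
      ∑ G, graphWeight p G * ((decode k G n).toOuterMeasure {L | Outcome.mk G L ∈ E}).toReal := by
  rw [Measure.real, runLaw,
    PMF.toMeasure_apply_eq_toOuterMeasure_apply _ MeasurableSpace.measurableSet_top,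
    PMF.toOuterMeasure_bind_apply, tsum_fintype, ENNReal.toReal_sum]
  · refine Finset.sum_congr rfl fun G _ => ?_
    rw [ENNReal.toReal_mul, graphLaw_toReal, PMF.toOuterMeasure_map_apply]
    rfl
  · intro G _
    refine ENNReal.mul_ne_top (PMF.apply_ne_top _ _) ?_
    refine ne_top_of_le_ne_top ENNReal.one_ne_top ?_
    rw [← ((PMF.toOuterMeasure_apply_eq_one_iff _ Set.univ).mpr (Set.subset_univ _))]
    exact measure_mono (Set.subset_univ _)

/-- The probability of an event about the graph and the first `t` resolved users. -/
theorem runLaw_real_prefix (p : unitInterval) {t : ℕ} (ht : t ≤ n)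
    (Q : Graph n m → List (Fin n) → Prop) [∀ G L, Decidable (Q G L)] :
    (runLaw n m k p).real {ω | t ≤ ω.resolved.length ∧ Q ω.graph (ω.resolved.take t)} =
      ∑ L ∈ orders n t, ∑ G, graphWeight p G * (prefixProb k G L * if Q G L then 1 else 0) := by
  rw [runLaw_real, Finset.sum_comm]
  refine Finset.sum_congr rfl fun G _ => ?_
  rw [← Finset.mul_sum]
  congr 1
  have h1 : {L : List (Fin n) | Outcome.mk G L ∈
      {ω : Outcome n m | t ≤ ω.resolved.length ∧ Q ω.graph (ω.resolved.take t)}} =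
      (fun L => if t ≤ L.length then some (L.take t) else none) ⁻¹' {o | ∃ L, o = some L ∧ Q G L} := by
    ext L
    by_cases h : t ≤ L.length <;> simp [h]
  rw [h1, ← PMF.toOuterMeasure_map_apply, map_prefix_decode G ht, PMF.toOuterMeasure_map_apply]
  classical
  rw [toOuterMeasure_toReal_eq_sum _ (orders n t)]
  · refine Finset.sum_congr rfl fun L hL => ?_
    obtain ⟨_, rfl⟩ := mem_orders.mp hL
    by_cases hQ : Q G L <;> simp [hQ, prefixProb]
  · intro L hL hE
    obtain ⟨hnd, hlen, _⟩ := mem_support_decode hL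
    rw [mem_orders]
    refine ⟨hnd, le_antisymm hlen ?_⟩
    by_contra hlt
    simp [hlt] at hE

/-- A list is the final one exactly if it is reached and leaves no decodable slot. -/
theorem decode_toReal_eq {G : Graph n m} {L : List (Fin n)} (hL : L.Nodup) :
    (decode k G n L).toReal =
      prefixProb k G L * if lowest k G (unresolved L) = ∅ then 1 else 0 := by
  have key : ∀ T, L.length ≤ T → (L.length < T ∨ lowest k G (unresolved L) = ∅) →
      (decode k G T L).toReal =
        prefixProb k G L * if lowest k G (unresolved L) = ∅ then 1 else 0 := by
    intro T hT
    induction T, hT using Nat.le_induction with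
    | base => intro h; simp [prefixProb, h.resolve_left (lt_irrefl _)]
    | succ T hT ih =>
      intro _
      by_cases he : lowest k G (unresolved L) = ∅
      · rw [← ih (Or.inr he), decode, PMF.bind_apply, tsum_eq_single L]
        · simp [step_of_lowest_eq_empty he]
        · intro L' hL'
          by_contra hne
          obtain ⟨h1, h2⟩ := mul_ne_zero_iff.mp hne
          rcases (lowest k G (unresolved L')).eq_empty_or_nonempty with he' | hl
          · rw [step_of_lowest_eq_empty he'] at h2
            exact hL' (by simpa using (PMF.mem_support_iff _ _).mpr h2 : L = L').symm
          · obtain ⟨w, _, rfl⟩ := mem_support_step ((PMF.mem_support_iff _ _).mpr h2) hl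
            refine hl.ne_empty ((mem_support_decode ((PMF.mem_support_iff _ _).mpr h1)).2.2 ?_)
            simp at hT
            omega
      · have h0 : decode k G (T + 1) L = 0 := by
          by_contra h
          exact he ((mem_support_decode ((PMF.mem_support_iff _ _).mpr h)).2.2 (by omega))
        simp [h0, he]
  have hlen : L.length ≤ n := by simpa using hL.length_le_card
  refine key n hlen ?_
  rcases hlen.lt_or_eq with h | h
  · exact Or.inl h
  · right
    have hU : unresolved L = ∅ := by
      rw [← Finset.card_eq_zero, card_unresolved hL, h, Nat.sub_self]
    rw [lowest_eq_empty_iff]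
    simp [decodable, redDeg, present, hU]

/-- The probability of an event about the graph and the list of all resolved users. -/
theorem runLaw_real_final (p : unitInterval) (Q : List (Fin n) → Prop) [DecidablePred Q] :
    (runLaw n m k p).real {ω | Q ω.resolved} =
      ∑ t ∈ Finset.range (n + 1), ∑ L ∈ orders n t with Q L,
        ∑ G : Graph n m, graphWeight p G *
        (prefixProb k G L * if lowest k G (unresolved L) = ∅ then 1 else 0) := by
  classical
  have hdisj : ((Finset.range (n + 1) : Finset ℕ) : Set ℕ).PairwiseDisjoint (orders n) := by
    intro a _ b _ hab
    rw [Function.onFun, Finset.disjoint_left]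
    intro L h1 h2
    exact hab ((mem_orders.mp h1).2.symm.trans (mem_orders.mp h2).2)
  simp_rw [Finset.sum_filter]
  rw [runLaw_real, ← Finset.sum_biUnion hdisj]
  simp_rw [← Finset.sum_filter]
  rw [Finset.sum_comm]
  refine Finset.sum_congr rfl fun G _ => ?_
  rw [← Finset.mul_sum]
  congr 1
  rw [toOuterMeasure_toReal_eq_sum _ ((Finset.range (n + 1)).biUnion (orders n)),
    Finset.sum_filter]
  · refine Finset.sum_congr rfl fun L hL => ?_
    obtain ⟨t, _, hL⟩ := Finset.mem_biUnion.mp hL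
    rw [decode_toReal_eq (mem_orders.mp hL).1]
    rfl
  · intro L hL _
    obtain ⟨hnd, hlen, _⟩ := mem_support_decode hL
    exact Finset.mem_biUnion.mpr ⟨L.length, by simpa using Nat.lt_succ_of_le hlen,
      mem_orders.mpr ⟨hnd, rfl⟩⟩

/-! ### The content of a single slot -/

/-- The number of users of `U` that transmit in a slot with transmission pattern `x`. -/
def slotDeg (U : Finset (Fin n)) (x : Fin n → Bool) : ℕ := (U.filter fun v => x v = true).card

theorem redDeg_eq_slotDeg (G : Graph n m) (U : Finset (Fin n)) (j : Fin m) :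
    redDeg G U j = slotDeg U (G j) := rfl

/-- The users outside `U` that transmit in a slot with transmission pattern `x`. -/
def slotOutside (U : Finset (Fin n)) (x : Fin n → Bool) : Finset (Fin n) :=
  Uᶜ.filter fun v => x v = true

theorem slotWeight_eq (p : ℝ) (x : Fin n → Bool) (U : Finset (Fin n)) :
    slotWeight p x = p ^ slotDeg U x * (1 - p) ^ (U.card - slotDeg U x) *
      (p ^ (slotOutside U x).card * (1 - p) ^ (n - U.card - (slotOutside U x).card)) := by
  have key : ∀ V : Finset (Fin n), ∏ v ∈ V, (if x v then p else 1 - p) =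
      p ^ (V.filter fun v => x v = true).card *
        (1 - p) ^ (V.card - (V.filter fun v => x v = true).card) := by
    intro V
    rw [Finset.prod_ite, Finset.prod_const, Finset.prod_const]
    congr 2
    have := Finset.card_filter_add_card_filter_not (s := V) (fun v => x v = true)
    omega
  have hc : Uᶜ.card = n - U.card := by rw [Finset.card_compl, Fintype.card_fin]
  rw [slotWeight, ← Finset.prod_mul_prod_compl U, key U, key Uᶜ, hc]
  rfl

theorem slotWeight_nonneg {p : ℝ} (h0 : 0 ≤ p) (h1 : p ≤ 1) (x : Fin n → Bool) :
    0 ≤ slotWeight p x := by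
  refine Finset.prod_nonneg fun v _ => ?_
  split_ifs <;> linarith

theorem sum_pattern_eq_sum_powerset (U : Finset (Fin n))
    (f : Finset (Fin n) → Finset (Fin n) → ℝ) :
    ∑ x : Fin n → Bool, f (U.filter fun v => x v = true) (slotOutside U x) =
      ∑ B ∈ U.powerset, ∑ C ∈ Uᶜ.powerset, f B C := by
  rw [← Finset.sum_product']
  refine Finset.sum_nbij' (fun x => (U.filter fun v => x v = true, slotOutside U x))
    (fun BC v => decide (v ∈ BC.1 ∪ BC.2)) ?_ ?_ ?_ ?_ ?_
  · intro x _
    simp [slotOutside]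
  · intro BC _
    simp
  · intro x _
    funext v
    by_cases hv : v ∈ U <;> simp [slotOutside, hv]
  · rintro ⟨B, C⟩ h
    simp only [Finset.mem_product, Finset.mem_powerset] at h
    have hB : ∀ v ∈ B, v ∈ U := fun v hv => h.1 hv
    have hC : ∀ v ∈ C, v ∉ U := fun v hv => by simpa using h.2 hv
    ext v <;> simp only [slotOutside, Finset.mem_filter, Finset.mem_compl, Finset.mem_union,
      decide_eq_true_eq] <;> grind
  · intro x _
    rfl

theorem card_powersetCard_filter_mem {α : Type*} [DecidableEq α] {U : Finset α} {v : α}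
    (hv : v ∈ U) (h : ℕ) :
    (((U.powersetCard (h + 1)).filter fun B => v ∈ B).card : ℕ) = (U.card - 1).choose h := by
  obtain ⟨V, hV, rfl⟩ : ∃ V, v ∉ V ∧ insert v V = U :=
    ⟨U.erase v, Finset.notMem_erase v U, Finset.insert_erase hv⟩
  rw [Finset.powersetCard_succ_insert hV, Finset.filter_union, Finset.filter_false_of_mem,
    Finset.empty_union, Finset.filter_true_of_mem, Finset.card_image_of_injOn,
    Finset.card_powersetCard, Finset.card_insert_of_notMem hV, Nat.add_sub_cancel]
  · intro B hB C hC hBC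
    have h1 : v ∉ B := fun h' => hV ((Finset.mem_powersetCard.mp hB).1 h')
    have h2 : v ∉ C := fun h' => hV ((Finset.mem_powersetCard.mp hC).1 h')
    rw [← Finset.erase_insert h1, ← Finset.erase_insert h2, hBC]
  · intro B hB
    obtain ⟨C, _, rfl⟩ := Finset.mem_image.mp hB
    exact Finset.mem_insert_self v C
  · intro B hB hvB
    exact hV ((Finset.mem_powersetCard.mp hB).1 hvB)

/-- Total weight of the patterns with `h` users in `U`, weighted by a function of the users outside
`U`. -/
theorem sum_slotWeight_deg (p : ℝ) (U : Finset (Fin n)) (h : ℕ) (g : Finset (Fin n) → ℝ) :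
    ∑ x : Fin n → Bool, slotWeight p x * (if slotDeg U x = h then g (slotOutside U x) else 0) =
      (U.card.choose h : ℝ) * (p ^ h * (1 - p) ^ (U.card - h)) *
        ∑ C ∈ Uᶜ.powerset, p ^ C.card * (1 - p) ^ (n - U.card - C.card) * g C := by
  refine (Finset.sum_congr rfl fun x _ => ?_).trans ((sum_pattern_eq_sum_powerset U fun B C =>
    if B.card = h then (p ^ h * (1 - p) ^ (U.card - h)) *
      (p ^ C.card * (1 - p) ^ (n - U.card - C.card) * g C) else 0).trans ?_)
  · change _ = if slotDeg U x = h then _ else _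
    rw [slotWeight_eq p x U]
    split_ifs with hd
    · rw [hd]; ring
    · ring
  rw [← Finset.card_powersetCard h U, Finset.powersetCard_eq_filter, Finset.card_filter,
    Nat.cast_sum, Finset.sum_mul, Finset.sum_mul]
  refine Finset.sum_congr rfl fun B _ => ?_
  split_ifs <;> simp [Finset.mul_sum]

/-- Total weight of the patterns with `h + 1` users in `U`, among them a given user. -/
theorem sum_slotWeight_deg_mem (p : ℝ) {U : Finset (Fin n)} {v : Fin n} (hv : v ∈ U) (h : ℕ)
    (g : Finset (Fin n) → ℝ) :
    ∑ x : Fin n → Bool, slotWeight p x *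
        (if slotDeg U x = h + 1 ∧ x v = true then g (slotOutside U x) else 0) =
      ((U.card - 1).choose h : ℝ) * (p ^ (h + 1) * (1 - p) ^ (U.card - (h + 1))) *
        ∑ C ∈ Uᶜ.powerset, p ^ C.card * (1 - p) ^ (n - U.card - C.card) * g C := by
  refine (Finset.sum_congr rfl fun x _ => ?_).trans ((sum_pattern_eq_sum_powerset U fun B C =>
    if B.card = h + 1 ∧ v ∈ B then (p ^ (h + 1) * (1 - p) ^ (U.card - (h + 1))) *
      (p ^ C.card * (1 - p) ^ (n - U.card - C.card) * g C) else 0).trans ?_)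
  · change _ = if slotDeg U x = h + 1 ∧ v ∈ U.filter (fun v => x v = true) then _ else _
    rw [slotWeight_eq p x U]
    simp only [Finset.mem_filter, hv, true_and]
    split_ifs with hd
    · rw [hd.1]; ring
    · ring
  rw [← card_powersetCard_filter_mem hv h, Finset.powersetCard_eq_filter, Finset.filter_filter,
    Finset.card_filter, Nat.cast_sum, Finset.sum_mul, Finset.sum_mul]
  refine Finset.sum_congr rfl fun B _ => ?_
  split_ifs <;> simp [Finset.mul_sum]

/-- Given the number `h` of its users in `U` and its users outside `U`, a slot contains each user of
`U` with probability `h / |U|`. -/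
theorem sum_slotWeight_deg_mem_eq (p : ℝ) {U : Finset (Fin n)} {v : Fin n} (hv : v ∈ U) (h : ℕ)
    (g : Finset (Fin n) → ℝ) :
    ∑ x : Fin n → Bool, slotWeight p x *
        (if slotDeg U x = h ∧ x v = true then g (slotOutside U x) else 0) =
      ((h : ℝ) / U.card) * ∑ x : Fin n → Bool, slotWeight p x *
        (if slotDeg U x = h then g (slotOutside U x) else 0) := by
  have hpos : 0 < U.card := Finset.card_pos.mpr ⟨v, hv⟩
  cases h with
  | zero =>
    rw [Nat.cast_zero, zero_div, zero_mul]
    refine Finset.sum_eq_zero fun x _ => ?_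
    rw [if_neg, mul_zero]
    rintro ⟨hd, hx⟩
    exact Finset.card_ne_zero_of_mem (Finset.mem_filter.mpr ⟨hv, hx⟩) hd
  | succ h =>
    rw [sum_slotWeight_deg_mem p hv, sum_slotWeight_deg]
    have hch : (U.card : ℝ) * ((U.card - 1).choose h : ℝ) =
        (U.card.choose (h + 1) : ℝ) * ((h + 1 : ℕ) : ℝ) := by
      have := Nat.add_one_mul_choose_eq (U.card - 1) h
      rw [Nat.sub_add_cancel hpos] at this
      exact_mod_cast this
    have hne : (U.card : ℝ) ≠ 0 := by exact_mod_cast hpos.ne'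
    have : ((U.card - 1).choose h : ℝ) =
        ((h + 1 : ℕ) : ℝ) / U.card * (U.card.choose (h + 1) : ℝ) := by
      field_simp
      linarith
    rw [this]
    ring

theorem sum_powerset_pow (p : ℝ) (V : Finset (Fin n)) :
    ∑ C ∈ V.powerset, p ^ C.card * (1 - p) ^ (V.card - C.card) = 1 := by
  rw [Finset.sum_pow_mul_eq_add_pow]
  simp

theorem sum_slotWeight_deg_eq (p : ℝ) (U : Finset (Fin n)) (h : ℕ) :
    ∑ x : Fin n → Bool, slotWeight p x * (if slotDeg U x = h then 1 else 0) =
      (U.card.choose h : ℝ) * (p ^ h * (1 - p) ^ (U.card - h)) := by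
  have hc : Uᶜ.card = n - U.card := by rw [Finset.card_compl, Fintype.card_fin]
  rw [sum_slotWeight_deg p U h (fun _ => 1)]
  simp_rw [mul_one]
  rw [← hc, sum_powerset_pow, mul_one]

theorem sum_slotWeight (p : ℝ) : ∑ x : Fin n → Bool, slotWeight p x = 1 := by
  have := sum_slotWeight_deg_eq p (∅ : Finset (Fin n)) 0
  simpa [slotDeg] using this

theorem sum_slotWeight_lt_deg (p : ℝ) (U : Finset (Fin n)) :
    ∑ x : Fin n → Bool, slotWeight p x * (if k < slotDeg U x then 1 else 0) =
      1 - ∑ h ∈ Finset.Icc 0 k, (U.card.choose h : ℝ) * (p ^ h * (1 - p) ^ (U.card - h)) := by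
  refine eq_sub_of_add_eq (Eq.trans ?_ (sum_slotWeight (n := n) p))
  simp_rw [← sum_slotWeight_deg_eq]
  rw [Finset.sum_comm, ← Finset.sum_add_distrib]
  refine Finset.sum_congr rfl fun x _ => ?_
  rw [← Finset.mul_sum, ← mul_add, Finset.sum_ite_eq]
  by_cases hx : k < slotDeg U x
  · simp [hx, Nat.not_le.mpr hx]
  · simp [hx, Nat.not_lt.mp hx]

theorem sum_Icc_choose_mul_pow (p : ℝ) {h u : ℕ} (hu : h ≤ u) (hn : u ≤ n) :
    ∑ d ∈ Finset.Icc h n, ((n - u).choose (d - h) : ℝ) * (p ^ d * (1 - p) ^ (n - d)) =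
      p ^ h * (1 - p) ^ (u - h) := by
  have hI : Finset.Icc h n = Finset.Ico h (n + 1) := by ext; simp
  rw [hI, Finset.sum_Ico_eq_sum_range]
  rw [← Finset.sum_subset (Finset.range_subset_range.mpr (show n - u + 1 ≤ n + 1 - h by omega))]
  · have hb := add_pow p (1 - p) (n - u)
    rw [add_sub_cancel, one_pow] at hb
    refine Eq.trans ?_ ((congrArg (p ^ h * (1 - p) ^ (u - h) * ·) hb.symm).trans (mul_one _))
    rw [Finset.mul_sum]
    refine Finset.sum_congr rfl fun e he => ?_
    rw [Finset.mem_range] at he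
    rw [Nat.add_sub_cancel_left, show n - (h + e) = (u - h) + (n - u - e) by omega, pow_add,
      pow_add]
    ring
  · intro e _ he
    rw [Finset.mem_range] at he
    rw [Nat.add_sub_cancel_left, Nat.choose_eq_zero_of_lt (by omega), Nat.cast_zero, zero_mul]

theorem cloudExitProb_eq (p : ℝ) {u : ℕ} (h1 : 1 ≤ u) (hn : u ≤ n) :
    cloudExitProb n k p u =
      (((u - 1).choose k : ℝ) * (p ^ (k + 1) * (1 - p) ^ (u - (k + 1)))) /
        (1 - ∑ h ∈ Finset.Icc 0 k, (u.choose h : ℝ) * (p ^ h * (1 - p) ^ (u - h))) := by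
  rw [cloudExitProb]
  congr 1
  · rcases lt_or_ge (u - 1) k with hk | hk
    · simp [Nat.choose_eq_zero_of_lt hk]
    rw [← sum_Icc_choose_mul_pow p (show k + 1 ≤ u by omega) hn, Finset.mul_sum]
    refine Finset.sum_congr rfl fun d hd => ?_
    rw [Finset.mem_Icc] at hd
    obtain ⟨d', rfl⟩ : ∃ d', d = d' + 1 := ⟨d - 1, by omega⟩
    obtain ⟨n', rfl⟩ : ∃ n', n = n' + 1 := ⟨n - 1, by omega⟩
    have e1 : ((n' + 1 : ℕ) : ℝ) * (n'.choose d' : ℝ) =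
        ((n' + 1).choose (d' + 1) : ℝ) * ((d' + 1 : ℕ) : ℝ) := by
      exact_mod_cast Nat.add_one_mul_choose_eq n' d'
    have e2 : (n'.choose d' : ℝ) * (d'.choose k : ℝ) =
        (n'.choose k : ℝ) * ((n' - k).choose (d' - k) : ℝ) := by
      exact_mod_cast Nat.choose_mul (n := n') (by omega : k ≤ d')
    have p1 : (n'.choose k : ℝ) ≠ 0 := by
      exact_mod_cast (Nat.choose_pos (by omega : k ≤ n')).ne'
    have p2 : ((n' - k).choose (d' - k) : ℝ) ≠ 0 := by
      exact_mod_cast (Nat.choose_pos (by omega : d' - k ≤ n' - k)).ne'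
    have p3 : ((n' + 1 : ℕ) : ℝ) ≠ 0 := by exact_mod_cast Nat.succ_ne_zero n'
    rw [slotDegreeProb, show d' + 1 - k - 1 = d' - k by omega,
      show n' + 1 - k - 1 = n' - k by omega, show d' + 1 - (k + 1) = d' - k by omega,
      Nat.add_sub_cancel, Nat.add_sub_cancel]
    rw [show ((n' + 1).choose (d' + 1) : ℝ) * p ^ (d' + 1) * (1 - p) ^ (n' + 1 - (d' + 1)) *
        (((d' + 1 : ℕ) : ℝ) / ((n' + 1 : ℕ) : ℝ)) * (d'.choose k : ℝ) *
        (((u - 1).choose k : ℝ) / (n'.choose k : ℝ)) *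
        (((n' + 1 - u).choose (d' - k) : ℝ) / ((n' - k).choose (d' - k) : ℝ)) =
        ((((n' + 1).choose (d' + 1) : ℝ) * ((d' + 1 : ℕ) : ℝ)) * (d'.choose k : ℝ)) /
          (((n' + 1 : ℕ) : ℝ) * ((n'.choose k : ℝ) * ((n' - k).choose (d' - k) : ℝ))) *
        (((u - 1).choose k : ℝ) * (((n' + 1 - u).choose (d' - k) : ℝ) *
          (p ^ (d' + 1) * (1 - p) ^ (n' + 1 - (d' + 1))))) by
        field_simp]
    rw [← e1, mul_assoc, e2, div_self (by positivity), one_mul]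
  · congr 1
    refine Finset.sum_congr rfl fun h _ => ?_
    rcases lt_or_ge u h with hlt | hle
    · simp [Nat.choose_eq_zero_of_lt hlt]
    rw [← sum_Icc_choose_mul_pow p hle hn, Finset.mul_sum]
    refine Finset.sum_congr rfl fun d hd => ?_
    rw [Finset.mem_Icc] at hd
    have : (n.choose d : ℝ) ≠ 0 := by exact_mod_cast (Nat.choose_pos hd.2).ne'
    rw [slotDegreeProb]
    field_simp

/-! ### What the decoder has seen of a slot -/

/-- What the decoder has seen of a slot when `U` is the set of unresolved users: nothing if the slot
is still in the cloud, otherwise its resolved users and its reduced degree. -/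
def slotInfo (k : ℕ) (U : Finset (Fin n)) (x : Fin n → Bool) : Option (Finset (Fin n) × ℕ) :=
  if k < slotDeg U x then none else some (slotOutside U x, slotDeg U x)

/-- The probability that the resolution of one of `u` users takes a slot of reduced degree `d` out
of its ripple, or out of the cloud. -/
noncomputable def leaveProb (n k : ℕ) (p : ℝ) (u d : ℕ) : ℝ :=
  if k < d then cloudExitProb n k p u else (d : ℝ) / u

/-- A slot is seen to change by the resolution of user `v`: it contains `v`, and it does not stay in
the cloud. -/
def Leaves (k : ℕ) (U : Finset (Fin n)) (v : Fin n) (x : Fin n → Bool) : Prop :=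
  x v = true ∧ slotDeg U x ≤ k + 1

instance (U : Finset (Fin n)) (v : Fin n) : DecidablePred (Leaves k U v) :=
  fun _ => inferInstanceAs (Decidable (_ ∧ _))

/-- Given what the decoder has seen of a slot, the slot leaves its class with probability
`leaveProb`. -/
theorem sum_slotWeight_leaves {p : ℝ} (h0 : 0 ≤ p) (h1 : p ≤ 1) {U : Finset (Fin n)} {v : Fin n}
    (hv : v ∈ U) (i : Option (Finset (Fin n) × ℕ)) :
    ∑ x with slotInfo k U x = i, slotWeight p x * (if Leaves k U v x then 1 else 0) =
      ∑ x with slotInfo k U x = i, slotWeight p x * leaveProb n k p U.card (slotDeg U x) := by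
  have hpos : 0 < U.card := Finset.card_pos.mpr ⟨v, hv⟩
  have hle : U.card ≤ n := by simpa using U.card_le_univ
  rw [Finset.sum_filter, Finset.sum_filter]
  cases i with
  | none =>
    have e1 : ∑ x : Fin n → Bool, (if slotInfo k U x = none then
          slotWeight p x * (if Leaves k U v x then 1 else 0) else 0) =
        ∑ x : Fin n → Bool, slotWeight p x *
          (if slotDeg U x = k + 1 ∧ x v = true then 1 else 0) := by
      refine Finset.sum_congr rfl fun x _ => ?_
      by_cases hk : k < slotDeg U x
      · by_cases hx : slotDeg U x = k + 1
        · simp [slotInfo, Leaves, hx]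
        · have : ¬ slotDeg U x ≤ k + 1 := by omega
          simp [slotInfo, Leaves, hx, this]
      · have : slotDeg U x ≠ k + 1 := by omega
        simp [slotInfo, hk, this]
    have e2 : ∑ x : Fin n → Bool, (if slotInfo k U x = none then
          slotWeight p x * leaveProb n k p U.card (slotDeg U x) else 0) =
        cloudExitProb n k p U.card *
          ∑ x : Fin n → Bool, slotWeight p x * (if k < slotDeg U x then 1 else 0) := by
      rw [Finset.mul_sum]
      refine Finset.sum_congr rfl fun x _ => ?_
      by_cases hk : k < slotDeg U x
      · simp [slotInfo, leaveProb, hk]; ring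
      · simp [slotInfo, hk]
    have e3 := sum_slotWeight_deg_mem p hv k (fun _ => 1)
    simp_rw [mul_one] at e3
    have hc : Uᶜ.card = n - U.card := by rw [Finset.card_compl, Fintype.card_fin]
    rw [← hc, sum_powerset_pow, mul_one] at e3
    rw [e1, e2, cloudExitProb_eq p hpos hle, ← sum_slotWeight_lt_deg, ← e3, div_mul_cancel_of_imp]
    -- if no slot can be in the cloud, the denominator of `q_u` vanishes, and so does its numerator
    intro hz
    refine le_antisymm (le_of_le_of_eq ?_ hz) (Finset.sum_nonneg fun x _ =>
      mul_nonneg (slotWeight_nonneg h0 h1 x) (by split_ifs <;> norm_num))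
    refine Finset.sum_le_sum fun x _ => mul_le_mul_of_nonneg_left ?_ (slotWeight_nonneg h0 h1 x)
    by_cases hx : slotDeg U x = k + 1 ∧ x v = true
    · rw [if_pos hx, if_pos (by omega)]
    · rw [if_neg hx]
      split_ifs <;> norm_num
  | some i =>
    obtain ⟨A, h⟩ := i
    have hinfo : ∀ x : Fin n → Bool, slotInfo k U x = some (A, h) ↔
        h ≤ k ∧ slotDeg U x = h ∧ slotOutside U x = A := by
      intro x
      rw [slotInfo]
      split_ifs with hk
      · simp; omega
      · simp; grind
    by_cases hk : h ≤ k
    · have e := sum_slotWeight_deg_mem_eq p hv h (fun C => if C = A then 1 else 0)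
      have hk' : h ≤ k + 1 := by omega
      have hk'' : ¬ k < h := by omega
      rw [Finset.mul_sum] at e
      refine Eq.trans ?_ (e.trans ?_)
      · refine Finset.sum_congr rfl fun x _ => ?_
        simp only [hinfo, Leaves]
        by_cases hx : slotDeg U x = h
        · by_cases hA : slotOutside U x = A <;> simp [hx, hA, hk, hk']
        · simp [hx]
      · refine Finset.sum_congr rfl fun x _ => ?_
        simp only [hinfo, leaveProb]
        by_cases hx : slotDeg U x = h
        · by_cases hA : slotOutside U x = A <;> simp [hx, hA, hk, hk'']; ring
        · simp [hx]
    · simp [hinfo, hk]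

/-! ### Independent slots and selections -/

/-- If, given `info x`, the weighted means of `f j` and `e j` agree for each `j`, then `f` may be
replaced with `e` in a sum over independent coordinates, next to a factor that depends on the
coordinates through their `info` only. -/
theorem sum_pi_mul_prod_congr {J X I : Type*} [Fintype J] [DecidableEq J] [Fintype X]
    [DecidableEq I] (w : X → ℝ) (info : X → I) (F : (J → X) → ℝ)
    (hF : ∀ G G', (∀ j, info (G j) = info (G' j)) → F G = F G') (f e : J → X → ℝ)
    (hfe : ∀ j i, ∑ x with info x = i, w x * f j x = ∑ x with info x = i, w x * e j x) :
    ∑ G : J → X, (∏ j, w (G j)) * (F G * ∏ j, f j (G j)) =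
      ∑ G : J → X, (∏ j, w (G j)) * (F G * ∏ j, e j (G j)) := by
  have hmaps : ∀ G ∈ (Finset.univ : Finset (J → X)),
      (fun j => info (G j)) ∈ Finset.univ.image fun (G : J → X) j => info (G j) :=
    fun G hG => Finset.mem_image_of_mem _ hG
  rw [← Finset.sum_fiberwise_of_maps_to hmaps, ← Finset.sum_fiberwise_of_maps_to hmaps]
  refine Finset.sum_congr rfl fun ι hι => ?_
  obtain ⟨G₀, _, rfl⟩ := Finset.mem_image.mp hι
  have hfilter :
      (Finset.univ.filter fun G : J → X => (fun j => info (G j)) = fun j => info (G₀ j)) =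
      Fintype.piFinset fun j => Finset.univ.filter fun x => info x = info (G₀ j) := by
    ext G
    simp [Fintype.mem_piFinset, funext_iff]
  have key : ∀ g : J → X → ℝ,
      ∑ G : J → X with (fun j => info (G j)) = fun j => info (G₀ j),
        (∏ j, w (G j)) * (F G * ∏ j, g j (G j)) =
      F G₀ * ∏ j, ∑ x with info x = info (G₀ j), w x * g j x := by
    intro g
    rw [Finset.prod_univ_sum, Finset.mul_sum, hfilter]
    refine Finset.sum_congr rfl fun G hG => ?_
    rw [hF G G₀ fun j => (Finset.mem_filter.mp (Fintype.mem_piFinset.mp hG j)).2,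
      Finset.prod_mul_distrib]
    ring
  rw [key, key]
  simp_rw [hfe]

/-- If the elements of `J` are selected independently, with probabilities that depend on their class
only, then the numbers of selected elements of the classes are independent and binomial. -/
theorem sum_selection_eq_prod_binomial {J T : Type*} [Fintype J] [DecidableEq J] [Fintype T]
    [DecidableEq T] (τ : J → T) (q : T → ℝ) (A : T → ℕ) :
    ∑ S : Finset J, (if ∀ h, (S.filter fun j => τ j = h).card = A h then 1 else 0) *
        ∏ j, (if j ∈ S then q (τ j) else 1 - q (τ j)) =
      ∏ h, ((Finset.univ.filter fun j => τ j = h).card.choose (A h) : ℝ) * q h ^ A h *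
        (1 - q h) ^ ((Finset.univ.filter fun j => τ j = h).card - A h) := by
  have hR : ∀ h, ((Finset.univ.filter fun j => τ j = h).card.choose (A h) : ℝ) * q h ^ A h *
      (1 - q h) ^ ((Finset.univ.filter fun j => τ j = h).card - A h) =
      ∑ _B ∈ (Finset.univ.filter fun j => τ j = h).powersetCard (A h), q h ^ A h *
        (1 - q h) ^ ((Finset.univ.filter fun j => τ j = h).card - A h) := by
    intro h
    rw [Finset.sum_const, Finset.card_powersetCard, nsmul_eq_mul, mul_assoc]
  rw [Finset.prod_congr rfl fun h _ => hR h, Finset.prod_univ_sum]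
  simp_rw [ite_mul, one_mul, zero_mul]
  rw [← Finset.sum_filter]
  refine Finset.sum_nbij' (fun S h => S.filter fun j => τ j = h)
    (fun P => Finset.univ.filter fun j => j ∈ P (τ j)) ?_ ?_ ?_ ?_ ?_
  · intro S hS
    rw [Fintype.mem_piFinset]
    intro h
    rw [Finset.mem_powersetCard]
    exact ⟨Finset.filter_subset_filter _ (Finset.subset_univ S), (Finset.mem_filter.mp hS).2 h⟩
  · intro P hP
    rw [Fintype.mem_piFinset] at hP
    refine Finset.mem_filter.mpr ⟨Finset.mem_univ _, fun h => ?_⟩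
    obtain ⟨h1, h2⟩ := Finset.mem_powersetCard.mp (hP h)
    rw [← h2]
    congr 1
    ext j
    simp only [Finset.mem_filter, Finset.mem_univ, true_and]
    constructor
    · rintro ⟨hj, rfl⟩
      exact hj
    · intro hj
      have := (Finset.mem_filter.mp (h1 hj)).2
      subst this
      exact ⟨hj, rfl⟩
  · intro S _
    ext j
    simp
  · intro P hP
    rw [Fintype.mem_piFinset] at hP
    funext h
    obtain ⟨h1, _⟩ := Finset.mem_powersetCard.mp (hP h)
    ext j
    simp only [Finset.mem_filter, Finset.mem_univ, true_and]
    constructor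
    · rintro ⟨hj, rfl⟩
      exact hj
    · intro hj
      have := (Finset.mem_filter.mp (h1 hj)).2
      subst this
      exact ⟨hj, rfl⟩
  · intro S hS
    rw [← Finset.prod_fiberwise_of_maps_to (g := τ) (t := Finset.univ) fun j _ =>
      Finset.mem_univ (τ j)]
    refine Finset.prod_congr rfl fun h _ => ?_
    have hA := (Finset.mem_filter.mp hS).2 h
    have e1 : ∏ j with τ j = h, (if j ∈ S then q (τ j) else 1 - q (τ j)) =
        ∏ j with τ j = h, (if j ∈ S then q h else 1 - q h) :=
      Finset.prod_congr rfl fun j hj => by rw [(Finset.mem_filter.mp hj).2]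
    rw [e1, Finset.prod_ite, Finset.prod_const, Finset.prod_const]
    have e2 : ((Finset.univ.filter fun j => τ j = h).filter fun j => j ∈ S).card = A h := by
      rw [← hA]
      congr 1
      ext j
      simp [and_comm]
    have := Finset.card_filter_add_card_filter_not
      (s := Finset.univ.filter fun j => τ j = h) (fun j => j ∈ S)
    rw [e2, show ((Finset.univ.filter fun j => τ j = h).filter fun j => j ∉ S).card =
      (Finset.univ.filter fun j => τ j = h).card - A h by omega]

/-! ### What the decoder has seen of the graph -/

theorem slotDeg_erase {U : Finset (Fin n)} {v : Fin n} (hv : v ∈ U) (x : Fin n → Bool) :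
    slotDeg U x = slotDeg (U.erase v) x + if x v = true then 1 else 0 := by
  rw [slotDeg, slotDeg, Finset.filter_erase]
  split_ifs with hx
  · rw [Finset.card_erase_add_one (Finset.mem_filter.mpr ⟨hv, hx⟩)]
  · rw [Finset.erase_eq_of_notMem (by simp [hx]), add_zero]

theorem slotDeg_eq_of_slotInfo_eq {U : Finset (Fin n)} {x y : Fin n → Bool}
    (h : slotInfo k U x = slotInfo k U y) :
    (k < slotDeg U x ∧ k < slotDeg U y) ∨
      (slotDeg U x = slotDeg U y ∧ slotOutside U x = slotOutside U y) := by
  unfold slotInfo at h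
  split_ifs at h with h1 h2 h2
  · exact Or.inl ⟨h1, h2⟩
  · simp only [Option.some.injEq, Prod.mk.injEq] at h
    exact Or.inr ⟨h.2, h.1⟩

theorem slotInfo_eq_of_erase {U : Finset (Fin n)} {v : Fin n} {x y : Fin n → Bool}
    (h : slotInfo k (U.erase v) x = slotInfo k (U.erase v) y) :
    slotInfo k U x = slotInfo k U y ∧ (v ∈ U → slotDeg U x ≤ k → x v = y v) := by
  by_cases hv : v ∈ U
  swap
  · rw [Finset.erase_eq_of_notMem hv] at h
    exact ⟨h, fun h' => absurd h' hv⟩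
  have ex := slotDeg_erase hv x
  have ey := slotDeg_erase hv y
  rcases slotDeg_eq_of_slotInfo_eq h with ⟨h1, h2⟩ | ⟨h1, h2⟩
  · have h1' : k < slotDeg U x := by omega
    have h2' : k < slotDeg U y := by omega
    exact ⟨by rw [slotInfo, slotInfo, if_pos h1', if_pos h2'], fun _ h3 => by omega⟩
  · have hmem : ∀ z : Fin n → Bool, v ∈ slotOutside (U.erase v) z ↔ z v = true := by
      intro z; simp [slotOutside]
    have hxy : x v = y v := by
      have := (hmem x).symm.trans ((by rw [h2] : _ ↔ _).trans (hmem y))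
      rwa [Bool.eq_iff_iff]
    have hd : slotDeg U x = slotDeg U y := by rw [ex, ey, h1, hxy]
    have ho : ∀ z : Fin n → Bool, slotOutside U z = (slotOutside (U.erase v) z).erase v := by
      intro z
      ext a
      by_cases hav : a = v
      · subst hav; simp [slotOutside, hv]
      · simp [slotOutside, hav]
    exact ⟨by rw [slotInfo, slotInfo, ho x, ho y, hd, h2], fun _ _ => hxy⟩

theorem decodable_congr {U : Finset (Fin n)} {G G' : Graph n m}
    (h : ∀ j, slotInfo k U (G j) = slotInfo k U (G' j)) :
    decodable k G U = decodable k G' U := by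
  refine Finset.filter_congr fun j _ => ?_
  rw [redDeg_eq_slotDeg, redDeg_eq_slotDeg]
  have := slotDeg_eq_of_slotInfo_eq (h j)
  omega

theorem redDeg_congr {U : Finset (Fin n)} {G G' : Graph n m}
    (h : ∀ j, slotInfo k U (G j) = slotInfo k U (G' j)) {j : Fin m} (hj : j ∈ decodable k G U) :
    redDeg G U j = redDeg G' U j := by
  have hd : redDeg G U j ≤ k := (Finset.mem_filter.mp hj).2.2
  rw [redDeg_eq_slotDeg] at hd ⊢
  rw [redDeg_eq_slotDeg]
  have := slotDeg_eq_of_slotInfo_eq (h j)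
  omega

theorem lowest_congr {U : Finset (Fin n)} {G G' : Graph n m}
    (h : ∀ j, slotInfo k U (G j) = slotInfo k U (G' j)) : lowest k G U = lowest k G' U := by
  rw [lowest, lowest, ← decodable_congr h]
  refine Finset.filter_congr fun j hj => forall₂_congr fun i hi => ?_
  rw [redDeg_congr h hj, redDeg_congr h hi]

theorem stateOf_congr {U : Finset (Fin n)} {G G' : Graph n m}
    (h : ∀ j, slotInfo k U (G j) = slotInfo k U (G' j)) : stateOf k G U = stateOf k G' U := by
  refine Prod.ext ?_ (funext fun i => ?_)
  · change (cloud k G U).card = (cloud k G' U).card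
    refine congrArg Finset.card (Finset.filter_congr fun j _ => ?_)
    rw [redDeg_eq_slotDeg, redDeg_eq_slotDeg]
    have := slotDeg_eq_of_slotInfo_eq (h j)
    omega
  · change (ripple G U (i.val + 1)).card = (ripple G' U (i.val + 1)).card
    refine congrArg Finset.card (Finset.filter_congr fun j _ => ?_)
    rw [redDeg_eq_slotDeg, redDeg_eq_slotDeg]
    have := slotDeg_eq_of_slotInfo_eq (h j)
    have := i.isLt
    omega

theorem resolveProb_congr {U : Finset (Fin n)} {v : Fin n} {G G' : Graph n m}
    (h : ∀ j, slotInfo k (U.erase v) (G j) = slotInfo k (U.erase v) (G' j)) :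
    resolveProb k G U v = resolveProb k G' U v := by
  have hU : ∀ j, slotInfo k U (G j) = slotInfo k U (G' j) := fun j => (slotInfo_eq_of_erase (h j)).1
  rw [resolveProb, resolveProb, ← lowest_congr hU]
  refine Finset.sum_congr rfl fun j hj => ?_
  have hj' := (Finset.mem_filter.mp hj).1
  have hd : slotDeg U (G j) ≤ k := (Finset.mem_filter.mp hj').2.2
  have hmem : v ∈ present G U j ↔ v ∈ present G' U j := by
    simp only [present, Finset.mem_filter]
    refine and_congr_right fun hv => ?_
    rw [(slotInfo_eq_of_erase (h j)).2 hv hd]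
  simp only [hmem, redDeg_congr hU hj']

/-- The past of the decoder depends only on what it has seen of the slots. In particular, it carries
no information on the content of a slot in the cloud, nor on which unresolved users a slot of a
given ripple contains. -/
theorem prefixProb_congr {L : List (Fin n)} {G G' : Graph n m}
    (h : ∀ j, slotInfo k (unresolved L) (G j) = slotInfo k (unresolved L) (G' j)) :
    prefixProb k G L = prefixProb k G' L := by
  induction L using List.reverseRecOn with
  | nil => rw [prefixProb_nil, prefixProb_nil]
  | append_singleton L v ih =>
    rw [unresolved_append] at h
    rw [prefixProb_append, prefixProb_append, resolveProb_congr h,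
      ih fun j => (slotInfo_eq_of_erase (h j)).1]

/-! ### The slots that leave their class -/

/-- The class of a slot: its reduced degree, or `k + 1` if the slot is in the cloud. -/
def slotClass (k : ℕ) (U : Finset (Fin n)) (x : Fin n → Bool) : Fin (k + 2) :=
  ⟨min (slotDeg U x) (k + 1), by omega⟩

/-- The number of slots of class `h`. -/
def classCard (k : ℕ) (G : Graph n m) (U : Finset (Fin n)) (h : Fin (k + 2)) : ℕ :=
  (Finset.univ.filter fun j => slotClass k U (G j) = h).card

/-- The number of slots that leave the class `h` when user `v` is resolved. -/
def leaveCard (k : ℕ) (G : Graph n m) (U : Finset (Fin n)) (v : Fin n) (h : Fin (k + 2)) : ℕ :=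
  ((Finset.univ.filter fun j => Leaves k U v (G j)).filter fun j => slotClass k U (G j) = h).card

theorem leaveProb_slotClass (p : ℝ) (u : ℕ) (U : Finset (Fin n)) (x : Fin n → Bool) :
    leaveProb n k p u (slotClass k U x) = leaveProb n k p u (slotDeg U x) := by
  rw [leaveProb, leaveProb]
  change (if k < min (slotDeg U x) (k + 1) then _ else ((min (slotDeg U x) (k + 1) : ℕ) : ℝ) / u) = _
  by_cases hk : k < slotDeg U x
  · rw [if_pos (by omega), if_pos hk]
  · rw [if_neg (by omega), if_neg hk, min_eq_left (by omega)]

/-- Given what the decoder has seen, the numbers of slots that leave the classes when `v` is resolved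
are independent and binomial. -/
theorem sum_graphWeight_leaveCard {p : ℝ} (h0 : 0 ≤ p) (h1 : p ≤ 1) {U : Finset (Fin n)} {v : Fin n}
    (hv : v ∈ U) (F : Graph n m → ℝ)
    (hF : ∀ G G' : Graph n m, (∀ j, slotInfo k U (G j) = slotInfo k U (G' j)) → F G = F G')
    (A : Fin (k + 2) → ℕ) :
    ∑ G : Graph n m, graphWeight p G * (F G * if leaveCard k G U v = A then 1 else 0) =
      ∑ G : Graph n m, graphWeight p G * (F G * ∏ h, ((classCard k G U h).choose (A h) : ℝ) *
        leaveProb n k p U.card h ^ A h *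
        (1 - leaveProb n k p U.card h) ^ (classCard k G U h - A h)) := by
  -- a sum over candidate sets `S` of leaving slots separates the slots
  have hsel : ∀ G : Graph n m, (if leaveCard k G U v = A then (1 : ℝ) else 0) =
      ∑ S : Finset (Fin m),
        (if ∀ h, (S.filter fun j => slotClass k U (G j) = h).card = A h then 1 else 0) *
        ∏ j, (if j ∈ S then (if Leaves k U v (G j) then 1 else 0)
          else 1 - (if Leaves k U v (G j) then 1 else 0)) := by
    intro G
    rw [Finset.sum_eq_single (Finset.univ.filter fun j => Leaves k U v (G j))]
    · rw [Finset.prod_eq_one, mul_one]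
      · simp only [funext_iff]
        rfl
      · intro j _
        by_cases hj : Leaves k U v (G j) <;> simp [hj]
    · intro S _ hS
      obtain ⟨j, hj⟩ : ∃ j, ¬ (j ∈ S ↔ Leaves k U v (G j)) := by
        by_contra hcon
        push Not at hcon
        exact hS (by ext j; simp [hcon])
      rw [Finset.prod_eq_zero (Finset.mem_univ j), mul_zero]
      by_cases h1 : j ∈ S <;> by_cases h2 : Leaves k U v (G j) <;> simp_all
    · simp
  have hclass : ∀ (S : Finset (Fin m)) (G G' : Graph n m),
      (∀ j, slotInfo k U (G j) = slotInfo k U (G' j)) →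
      F G * (if ∀ h, (S.filter fun j => slotClass k U (G j) = h).card = A h then 1 else 0) =
      F G' * (if ∀ h, (S.filter fun j => slotClass k U (G' j) = h).card = A h then 1 else 0) := by
    intro S G G' h
    have : ∀ j, slotClass k U (G j) = slotClass k U (G' j) := by
      intro j
      have := slotDeg_eq_of_slotInfo_eq (h j)
      apply Fin.ext
      change min _ _ = min _ _
      omega
    simp only [hF G G' h, this]
  have hslot : ∀ (S : Finset (Fin m)) (j : Fin m) (i : Option (Finset (Fin n) × ℕ)),
      ∑ x with slotInfo k U x = i, slotWeight p x *
        (if j ∈ S then (if Leaves k U v x then 1 else 0)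
          else 1 - (if Leaves k U v x then 1 else 0)) =
      ∑ x with slotInfo k U x = i, slotWeight p x *
        (if j ∈ S then leaveProb n k p U.card (slotClass k U x)
          else 1 - leaveProb n k p U.card (slotClass k U x)) := by
    intro S j i
    simp only [leaveProb_slotClass]
    by_cases hj : j ∈ S
    · simp only [if_pos hj]
      exact sum_slotWeight_leaves h0 h1 hv i
    · simp only [if_neg hj, mul_sub, Finset.sum_sub_distrib]
      rw [sum_slotWeight_leaves h0 h1 hv i]
  calc ∑ G : Graph n m, graphWeight p G * (F G * if leaveCard k G U v = A then 1 else 0)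
      = ∑ S : Finset (Fin m), ∑ G : Graph n m, graphWeight p G * ((F G *
          (if ∀ h, (S.filter fun j => slotClass k U (G j) = h).card = A h then 1 else 0)) *
          ∏ j, (if j ∈ S then (if Leaves k U v (G j) then 1 else 0)
            else 1 - (if Leaves k U v (G j) then 1 else 0))) := by
        rw [Finset.sum_comm]
        refine Finset.sum_congr rfl fun G _ => ?_
        rw [hsel, Finset.mul_sum, Finset.mul_sum]
        exact Finset.sum_congr rfl fun S _ => by rw [mul_assoc (F G)]
    _ = ∑ S : Finset (Fin m), ∑ G : Graph n m, graphWeight p G * ((F G *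
          (if ∀ h, (S.filter fun j => slotClass k U (G j) = h).card = A h then 1 else 0)) *
          ∏ j, (if j ∈ S then leaveProb n k p U.card (slotClass k U (G j))
            else 1 - leaveProb n k p U.card (slotClass k U (G j)))) := by
        refine Finset.sum_congr rfl fun S _ => ?_
        exact sum_pi_mul_prod_congr (slotWeight p) (slotInfo k U) _ (hclass S)
          (fun j x => if j ∈ S then (if Leaves k U v x then 1 else 0)
            else 1 - (if Leaves k U v x then 1 else 0))
          (fun j x => if j ∈ S then leaveProb n k p U.card (slotClass k U x)
            else 1 - leaveProb n k p U.card (slotClass k U x)) (hslot S)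
    _ = _ := by
        rw [Finset.sum_comm]
        refine Finset.sum_congr rfl fun G _ => ?_
        have := sum_selection_eq_prod_binomial (fun j => slotClass k U (G j))
          (fun h : Fin (k + 2) => leaveProb n k p U.card h) A
        unfold classCard
        rw [← this, Finset.mul_sum, Finset.mul_sum]
        exact Finset.sum_congr rfl fun S _ => by rw [mul_assoc (F G)]; congr

/-! ### One iteration -/

/-- The class of the slots of the `(i + 1)`-th ripple. -/
abbrev rippleClass (i : Fin k) : Fin (k + 2) := i.castSucc.succ

theorem slotClass_eq_rippleClass_iff (U : Finset (Fin n)) (x : Fin n → Bool) (i : Fin k) :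
    slotClass k U x = rippleClass i ↔ slotDeg U x = i.val + 1 := by
  rw [Fin.ext_iff]
  change min (slotDeg U x) (k + 1) = i.val + 1 ↔ _
  have := i.isLt
  omega

theorem slotClass_eq_last_iff (U : Finset (Fin n)) (x : Fin n → Bool) :
    slotClass k U x = Fin.last (k + 1) ↔ k < slotDeg U x := by
  rw [Fin.ext_iff]
  change min (slotDeg U x) (k + 1) = k + 1 ↔ _
  omega

theorem classCard_rippleClass (G : Graph n m) (U : Finset (Fin n)) (i : Fin k) :
    classCard k G U (rippleClass i) = (stateOf k G U).2 i := by
  change _ = (ripple G U (i.val + 1)).card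
  simp only [classCard, slotClass_eq_rippleClass_iff]
  rfl

theorem classCard_last (G : Graph n m) (U : Finset (Fin n)) :
    classCard k G U (Fin.last (k + 1)) = (stateOf k G U).1 := by
  change _ = (cloud k G U).card
  simp only [classCard, slotClass_eq_last_iff]
  rfl

theorem leaveCard_zero (G : Graph n m) {U : Finset (Fin n)} {v : Fin n} (hv : v ∈ U) :
    leaveCard k G U v 0 = 0 := by
  rw [leaveCard, Finset.card_eq_zero, Finset.filter_filter, Finset.filter_eq_empty_iff]
  rintro j - ⟨⟨hx, _⟩, hc⟩
  have h : slotDeg U (G j) ≠ 0 := Finset.card_ne_zero_of_mem (Finset.mem_filter.mpr ⟨hv, hx⟩)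
  have hc' : min (slotDeg U (G j)) (k + 1) = 0 := congrArg Fin.val hc
  omega

theorem leaveCard_rippleClass (G : Graph n m) (U : Finset (Fin n)) (v : Fin n) (i : Fin k) :
    leaveCard k G U v (rippleClass i) =
      (Finset.univ.filter fun j => G j v = true ∧ slotDeg U (G j) = i.val + 1).card := by
  rw [leaveCard, Finset.filter_filter]
  congr 1
  refine Finset.filter_congr fun j _ => ?_
  rw [slotClass_eq_rippleClass_iff, Leaves]
  have := i.isLt
  constructor
  · rintro ⟨⟨h1, _⟩, h2⟩; exact ⟨h1, h2⟩
  · rintro ⟨h1, h2⟩; exact ⟨⟨h1, by omega⟩, h2⟩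

theorem leaveCard_last (G : Graph n m) (U : Finset (Fin n)) (v : Fin n) :
    leaveCard k G U v (Fin.last (k + 1)) =
      (Finset.univ.filter fun j => G j v = true ∧ slotDeg U (G j) = k + 1).card := by
  rw [leaveCard, Finset.filter_filter]
  congr 1
  refine Finset.filter_congr fun j _ => ?_
  rw [slotClass_eq_last_iff, Leaves]
  constructor
  · rintro ⟨⟨h1, _⟩, h2⟩; exact ⟨h1, by omega⟩
  · rintro ⟨h1, h2⟩; exact ⟨⟨h1, by omega⟩, by omega⟩

theorem card_cloud_erase (G : Graph n m) {U : Finset (Fin n)} {v : Fin n} (hv : v ∈ U) :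
    (stateOf k G (U.erase v)).1 + leaveCard k G U v (Fin.last (k + 1)) = (stateOf k G U).1 := by
  rw [leaveCard_last]
  change (cloud k G (U.erase v)).card + _ = (cloud k G U).card
  simp only [cloud, Finset.card_filter]
  rw [← Finset.sum_add_distrib]
  refine Finset.sum_congr rfl fun j _ => ?_
  rw [redDeg_eq_slotDeg, redDeg_eq_slotDeg]
  have := slotDeg_erase hv (G j)
  by_cases hx : G j v = true
  · simp only [hx, if_true, true_and] at this ⊢
    split_ifs <;> omega
  · simp only [hx, Bool.false_eq_true, if_false, false_and] at this ⊢
    split_ifs <;> omega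

theorem card_ripple_erase (G : Graph n m) {U : Finset (Fin n)} {v : Fin n} (hv : v ∈ U) (h : ℕ) :
    (ripple G (U.erase v) h).card +
        (Finset.univ.filter fun j => G j v = true ∧ slotDeg U (G j) = h).card =
      (ripple G U h).card +
        (Finset.univ.filter fun j => G j v = true ∧ slotDeg U (G j) = h + 1).card := by
  simp only [ripple, Finset.card_filter]
  rw [← Finset.sum_add_distrib, ← Finset.sum_add_distrib]
  refine Finset.sum_congr rfl fun j _ => ?_
  rw [redDeg_eq_slotDeg, redDeg_eq_slotDeg]
  have := slotDeg_erase hv (G j)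
  by_cases hx : G j v = true
  · simp only [hx, if_true, true_and] at this ⊢
    split_ifs <;> omega
  · simp only [hx, Bool.false_eq_true, if_false, false_and] at this ⊢
    split_ifs <;> omega

/-- The new state is the old one, changed by the numbers of leaving slots. -/
theorem stateOf_erase_snd (G : Graph n m) {U : Finset (Fin n)} {v : Fin n} (hv : v ∈ U)
    (i : Fin k) :
    ((stateOf k G (U.erase v)).2 i : ℤ) = (stateOf k G U).2 i +
      (inflow (leaveCard k G U v (Fin.last (k + 1)) : ℤ)
        (fun i => (leaveCard k G U v (rippleClass i) : ℤ)) i - leaveCard k G U v (rippleClass i)) := by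
  have h := card_ripple_erase G hv (i.val + 1)
  rw [← leaveCard_rippleClass] at h
  change ((ripple G (U.erase v) (i.val + 1)).card : ℤ) = (ripple G U (i.val + 1)).card + _
  rw [inflow]
  split_ifs with hi
  · rw [leaveCard_rippleClass G U v ⟨i.val + 1, hi⟩]
    dsimp only
    omega
  · rw [leaveCard_last]
    have hk : k = i.val + 1 := by have := i.isLt; omega
    rw [show k + 1 = i.val + 1 + 1 by omega]
    omega

/-- The numbers of leaving slots are determined by the two states. -/
theorem eq_of_inflow_sub_eq {b b' : ℤ} {a a' : Fin k → ℤ} (hb : b = b')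
    (h : ∀ i, inflow b a i - a i = inflow b' a' i - a' i) : a = a' := by
  have key : ∀ d, ∀ i : Fin k, i.val + d + 1 = k → a i = a' i := by
    intro d
    induction d with
    | zero =>
      intro i hi
      have := h i
      rw [inflow, inflow, dif_neg (by omega), dif_neg (by omega)] at this
      omega
    | succ d ih =>
      intro i hi
      have := h i
      rw [inflow, inflow, dif_pos (by omega), dif_pos (by omega),
        ih ⟨i.val + 1, by omega⟩ (by dsimp only; omega)] at this
      omega
  funext i
  exact key (k - 1 - i.val) i (by have := i.isLt; omega)

theorem inflow_leaving (s s' : State k) (i : Fin k) :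
    (s'.2 i : ℤ) = s.2 i + (inflow ((s.1 : ℤ) - s'.1) (leaving s s') i - leaving s s' i) := by
  have hsplit : ∀ i : Fin k, ∑ j ∈ Finset.univ.filter (fun j => i ≤ j), ((s.2 j : ℤ) - s'.2 j) =
      ((s.2 i : ℤ) - s'.2 i) +
        ∑ j ∈ Finset.univ.filter (fun j => i < j), ((s.2 j : ℤ) - s'.2 j) := by
    intro i
    have : Finset.univ.filter (fun j => i ≤ j) =
        insert i (Finset.univ.filter (fun j => i < j)) := by
      ext j
      simp [le_iff_eq_or_lt, eq_comm]
    rw [this, Finset.sum_insert (by simp)]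
  rw [inflow]
  split_ifs with hi
  · rw [leaving, leaving, hsplit i]
    have : Finset.univ.filter (fun j : Fin k => (⟨i.val + 1, hi⟩ : Fin k) ≤ j) =
        Finset.univ.filter (fun j => i < j) := by
      ext j
      simp only [Finset.mem_filter, Finset.mem_univ, true_and, Fin.le_def, Fin.lt_def]
      omega
    rw [this]
    ring
  · rw [leaving, hsplit i]
    have : Finset.univ.filter (fun j : Fin k => i < j) = ∅ := by
      ext j
      simp only [Finset.mem_filter, Finset.mem_univ, true_and, Fin.lt_def, Finset.notMem_empty,
        iff_false]
      have := j.isLt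
      omega
    rw [this, Finset.sum_empty]
    ring

theorem exists_isLowestRipple {r : Fin k → ℕ} (h : 0 < ∑ i, r i) : ∃ i, IsLowestRipple r i := by
  have hne : (Finset.univ.filter fun i => 0 < r i).Nonempty := by
    rw [Finset.filter_nonempty_iff]
    by_contra hcon
    push Not at hcon
    rw [Finset.sum_eq_zero fun i hi => Nat.le_zero.mp (hcon i hi)] at h
    exact lt_irrefl _ h
  refine ⟨Finset.min' _ hne, (Finset.mem_filter.mp (Finset.min'_mem _ hne)).2,
    Finset.sum_eq_zero fun j hj => ?_⟩
  by_contra hr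
  have := Finset.min'_le (Finset.univ.filter fun i => 0 < r i) j
    (Finset.mem_filter.mpr ⟨Finset.mem_univ j, Nat.pos_of_ne_zero hr⟩)
  exact absurd (Finset.mem_filter.mp hj).2 (not_lt.mpr this)

theorem IsLowestRipple.unique {r : Fin k → ℕ} {i j : Fin k} (hi : IsLowestRipple r i)
    (hj : IsLowestRipple r j) : i = j := by
  have key : ∀ {i j : Fin k}, IsLowestRipple r i → IsLowestRipple r j → ¬ i < j := by
    intro i j hi hj hij
    have := Finset.sum_eq_zero_iff.mp hj.2 i (Finset.mem_filter.mpr ⟨Finset.mem_univ i, hij⟩)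
    exact hi.1.ne' this
  exact le_antisymm (not_lt.mp (key hj hi)) (not_lt.mp (key hi hj))

theorem lowest_eq_ripple {G : Graph n m} {U : Finset (Fin n)} {i : Fin k}
    (hi : IsLowestRipple (stateOf k G U).2 i) : lowest k G U = ripple G U (i.val + 1) := by
  have hzero : ∀ j, ¬ (1 ≤ redDeg G U j ∧ redDeg G U j < i.val + 1) := by
    rintro j ⟨h1, h2⟩
    have hik := i.isLt
    have := Finset.sum_eq_zero_iff.mp hi.2 ⟨redDeg G U j - 1, by omega⟩
      (Finset.mem_filter.mpr ⟨Finset.mem_univ _, by rw [Fin.lt_def]; dsimp only; omega⟩)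
    change (ripple G U (redDeg G U j - 1 + 1)).card = 0 at this
    rw [Finset.card_eq_zero, Finset.eq_empty_iff_forall_notMem] at this
    exact this j (Finset.mem_filter.mpr ⟨Finset.mem_univ j, by omega⟩)
  have hpos : 0 < (ripple G U (i.val + 1)).card := hi.1
  obtain ⟨j₀, hj₀⟩ := Finset.card_pos.mp hpos
  have hj₀ : redDeg G U j₀ = i.val + 1 := (Finset.mem_filter.mp hj₀).2
  have hik := i.isLt
  ext j
  simp only [lowest, decodable, ripple, Finset.mem_filter, Finset.mem_univ, true_and]
  constructor
  · rintro ⟨⟨h1, _⟩, h2⟩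
    have := h2 j₀ (by omega)
    have := hzero j
    omega
  · intro hj
    refine ⟨by omega, fun l hl => ?_⟩
    have := hzero l
    omega

theorem lowest_eq_empty_iff_stateOf {G : Graph n m} {U : Finset (Fin n)} :
    lowest k G U = ∅ ↔ ∑ i, (stateOf k G U).2 i = 0 := by
  constructor
  · intro h
    by_contra hne
    obtain ⟨i, hi⟩ := exists_isLowestRipple (Nat.pos_of_ne_zero hne)
    have hpos := hi.1
    rw [lowest_eq_ripple hi] at h
    change 0 < (ripple G U (i.val + 1)).card at hpos
    rw [h] at hpos
    exact lt_irrefl _ hpos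
  · intro h
    rw [lowest_eq_empty_iff, decodable, Finset.filter_eq_empty_iff]
    rintro j - ⟨h1, h2⟩
    have := Finset.sum_eq_zero_iff.mp h ⟨redDeg G U j - 1, by omega⟩ (Finset.mem_univ _)
    change (ripple G U (redDeg G U j - 1 + 1)).card = 0 at this
    rw [Finset.card_eq_zero, Finset.eq_empty_iff_forall_notMem] at this
    exact this j (Finset.mem_filter.mpr ⟨Finset.mem_univ j, by omega⟩)

/-- The next user is `v` with the probability that a random slot of the lowest ripple contains `v`,
divided by the reduced degree of this slot. -/
theorem resolveProb_eq {G : Graph n m} {U : Finset (Fin n)} {v : Fin n} (hv : v ∈ U) {i : Fin k}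
    (hi : IsLowestRipple (stateOf k G U).2 i) :
    resolveProb k G U v = (leaveCard k G U v (rippleClass i) : ℝ) *
      (((stateOf k G U).2 i : ℝ)⁻¹ * ((i.val + 1 : ℕ) : ℝ)⁻¹) := by
  rw [resolveProb, lowest_eq_ripple hi, leaveCard_rippleClass]
  change _ = _ * (((ripple G U (i.val + 1)).card : ℝ)⁻¹ * _)
  rw [← Finset.sum_filter, ← nsmul_eq_mul, ← Finset.sum_const]
  refine Finset.sum_congr ?_ fun j hj => ?_
  · ext j
    simp only [ripple, present, Finset.mem_filter, Finset.mem_univ, true_and, hv]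
    exact and_comm
  · rw [Finset.mem_filter] at hj
    rw [redDeg_eq_slotDeg, hj.2.2]

/-- Conditioning on the choice of the lowest ripple accounts for one trial and one success less. -/
theorem mul_binomial_eq (l h u A : ℕ) (hl : 0 < l) (hh : 0 < h) :
    (A : ℝ) * ((l : ℝ)⁻¹ * (h : ℝ)⁻¹) *
        ((l.choose A : ℝ) * ((h : ℝ) / u) ^ A * (1 - (h : ℝ) / u) ^ (l - A)) =
      (u : ℝ)⁻¹ * binomialTerm (l - 1) ((h : ℝ) / u) ((A : ℤ) - 1) := by
  cases A with
  | zero => simp [binomialTerm]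
  | succ A =>
    have h1 : ((A + 1 : ℕ) : ℤ) - 1 = (A : ℤ) := by push_cast; ring
    rw [h1, binomialTerm, if_pos (by positivity), Int.toNat_natCast]
    obtain ⟨l, rfl⟩ : ∃ l', l = l' + 1 := ⟨l - 1, by omega⟩
    have hch : ((l + 1 : ℕ) : ℝ) * (l.choose A : ℝ) =
        ((l + 1).choose (A + 1) : ℝ) * ((A + 1 : ℕ) : ℝ) := by
      exact_mod_cast Nat.add_one_mul_choose_eq l A
    rw [Nat.add_sub_cancel, show l + 1 - (A + 1) = l - A by omega, pow_succ]
    have hl' : ((l + 1 : ℕ) : ℝ) ≠ 0 := by positivity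
    have hh' : (h : ℝ) ≠ 0 := by positivity
    calc ((A + 1 : ℕ) : ℝ) * (((l + 1 : ℕ) : ℝ)⁻¹ * (h : ℝ)⁻¹) *
          (((l + 1).choose (A + 1) : ℝ) * (((h : ℝ) / u) ^ A * ((h : ℝ) / u)) *
            (1 - (h : ℝ) / u) ^ (l - A))
        = (((l + 1).choose (A + 1) : ℝ) * ((A + 1 : ℕ) : ℝ)) * (((l + 1 : ℕ) : ℝ)⁻¹ * (h : ℝ)⁻¹) *
          ((((h : ℝ) / u) ^ A * ((h : ℝ) / u)) * (1 - (h : ℝ) / u) ^ (l - A)) := by ring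
      _ = (((l + 1 : ℕ) : ℝ) * ((l + 1 : ℕ) : ℝ)⁻¹) * ((h : ℝ) * (h : ℝ)⁻¹) * ((u : ℝ)⁻¹ *
          ((l.choose A : ℝ) * ((h : ℝ) / u) ^ A * (1 - (h : ℝ) / u) ^ (l - A))) := by
        rw [← hch]; ring
      _ = _ := by rw [mul_inv_cancel₀ hl', mul_inv_cancel₀ hh']; ring

theorem transitionProb_of_neg {p : ℝ} {u : ℕ} {s : State k} {b : ℤ} {a : Fin k → ℤ}
    (h : b < 0 ∨ ∃ i, a i < 0) : transitionProb n k p u s b a = 0 := by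
  rw [transitionProb]
  rcases h with h | ⟨i, hi⟩
  · rw [binomialTerm, if_neg (by omega), zero_mul]
  · rw [Finset.prod_eq_zero (Finset.mem_univ i), mul_zero]
    rw [binomialTerm, if_neg]
    rw [successes]
    split_ifs <;> omega

/-- The joint law of two consecutive states, along a given order of resolution. -/
theorem sum_prefixProb_append {p : ℝ} (h0 : 0 ≤ p) (h1 : p ≤ 1) {L : List (Fin n)} {v : Fin n}
    (hv : v ∈ unresolved L) {s s' : State k} (hs : 0 < ∑ i, s.2 i) {b : ℤ} {a : Fin k → ℤ}
    (hb : (s'.1 : ℤ) = s.1 - b) (ha : ∀ i, (s'.2 i : ℤ) = s.2 i + (inflow b a i - a i)) :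
    ∑ G : Graph n m, graphWeight p G * (prefixProb k G (L ++ [v]) *
        if stateOf k G (unresolved L) = s ∧ stateOf k G (unresolved (L ++ [v])) = s' then 1 else 0) =
      ((unresolved L).card : ℝ)⁻¹ * (∑ G : Graph n m, graphWeight p G * (prefixProb k G L *
        if stateOf k G (unresolved L) = s then 1 else 0)) *
        transitionProb n k p (unresolved L).card s b a := by
  rw [unresolved_append]
  set U := unresolved L with hU
  -- the second state pins the numbers of leaving slots
  have hiff : ∀ G : Graph n m, stateOf k G U = s → (stateOf k G (U.erase v) = s' ↔
      (leaveCard k G U v (Fin.last (k + 1)) : ℤ) = b ∧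
        (fun i => (leaveCard k G U v (rippleClass i) : ℤ)) = a) := by
    intro G hG
    have e1 := card_cloud_erase (k := k) G hv
    have e2 := stateOf_erase_snd (k := k) G hv
    rw [hG] at e1 e2
    constructor
    · intro h
      rw [h] at e1 e2
      have hb' : (leaveCard k G U v (Fin.last (k + 1)) : ℤ) = b := by omega
      refine ⟨hb', eq_of_inflow_sub_eq hb' fun i => ?_⟩
      have := ha i
      have := e2 i
      omega
    · rintro ⟨h2, h3⟩
      refine Prod.ext (by omega) (funext fun i => ?_)
      have h4 := ha i
      have h5 := e2 i
      rw [h2, h3, congrFun h3 i] at h5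
      omega
  by_cases hneg : b < 0 ∨ ∃ i, a i < 0
  · rw [transitionProb_of_neg hneg, mul_zero]
    refine Finset.sum_eq_zero fun G _ => ?_
    rw [if_neg, mul_zero, mul_zero]
    rintro ⟨hG, hG'⟩
    obtain ⟨h2, h3⟩ := (hiff G hG).mp hG'
    rcases hneg with hneg | ⟨i, hi⟩
    · omega
    · rw [← h3] at hi
      dsimp only at hi
      omega
  push Not at hneg
  obtain ⟨b, rfl⟩ := Int.eq_ofNat_of_zero_le hneg.1
  obtain ⟨a, rfl⟩ : ∃ a' : Fin k → ℕ, a = fun i => (a' i : ℤ) :=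
    ⟨fun i => (a i).toNat, funext fun i => (Int.toNat_of_nonneg (hneg.2 i)).symm⟩
  let A : Fin (k + 2) → ℕ := Fin.cons 0 (Fin.snoc a b : Fin (k + 1) → ℕ)
  have hA0 : A 0 = 0 := rfl
  have hAr : ∀ i, A (rippleClass i) = a i := by
    intro i
    simp only [A, rippleClass, Fin.cons_succ, Fin.snoc_castSucc]
  have hAl : A (Fin.last (k + 1)) = b := by
    rw [← Fin.succ_last]
    simp only [A, Fin.cons_succ, Fin.snoc_last]
  have hiffA : ∀ G : Graph n m, stateOf k G U = s →
      (stateOf k G (U.erase v) = s' ↔ leaveCard k G U v = A) := by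
    intro G hG
    rw [hiff G hG]
    constructor
    · rintro ⟨h2, h3⟩
      funext h
      refine Fin.cases ?_ (fun h => ?_) h
      · rw [leaveCard_zero G hv, hA0]
      · refine Fin.lastCases ?_ (fun i => ?_) h
        · rw [Fin.succ_last, hAl]; exact_mod_cast h2
        · rw [hAr]; exact_mod_cast congrFun h3 i
    · intro h
      rw [h, hAl]
      refine ⟨rfl, funext fun i => ?_⟩
      rw [hAr]
  -- the probability of resolving `v` is a function of the two states
  obtain ⟨i, hi⟩ := exists_isLowestRipple hs
  have hfac : ∀ G : Graph n m, prefixProb k G (L ++ [v]) *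
      (if stateOf k G U = s ∧ stateOf k G (U.erase v) = s' then 1 else 0) =
      (prefixProb k G L * (if stateOf k G U = s then 1 else 0) *
        ((a i : ℝ) * ((s.2 i : ℝ)⁻¹ * ((i.val + 1 : ℕ) : ℝ)⁻¹))) *
        if leaveCard k G U v = A then 1 else 0 := by
    intro G
    by_cases hG : stateOf k G U = s
    · by_cases hG' : leaveCard k G U v = A
      · rw [if_pos ⟨hG, (hiffA G hG).mpr hG'⟩, if_pos hG, if_pos hG', prefixProb_append,
          resolveProb_eq hv (hG ▸ hi), hG', hG, hAr]
        ring
      · rw [if_neg fun h => hG' ((hiffA G hG).mp h.2), if_neg hG', mul_zero, mul_zero]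
    · simp [hG]
  simp_rw [hfac]
  rw [sum_graphWeight_leaveCard h0 h1 hv _ ?_ A, Finset.mul_sum, Finset.sum_mul]
  · refine Finset.sum_congr rfl fun G _ => ?_
    by_cases hG : stateOf k G U = s
    swap
    · simp [hG]
    rw [if_pos hG, mul_one, Fin.prod_univ_succ, Fin.prod_univ_castSucc, Fin.succ_last]
    have hz : leaveProb n k p U.card ((0 : Fin (k + 2)) : ℕ) = 0 := by simp [leaveProb]
    have hl : leaveProb n k p U.card ((Fin.last (k + 1) : Fin (k + 2)) : ℕ) =
        cloudExitProb n k p U.card := by simp [leaveProb]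
    have hr : ∀ i : Fin k, leaveProb n k p U.card (rippleClass i : Fin (k + 2)) =
        ((i.val + 1 : ℕ) : ℝ) / U.card := by
      intro i
      have hle : ¬ k < i.val + 1 := by have := i.isLt; omega
      rw [leaveProb]
      exact if_neg hle
    have hkey : (a i : ℝ) * ((s.2 i : ℝ)⁻¹ * ((i.val + 1 : ℕ) : ℝ)⁻¹) *
        ∏ j : Fin k, ((s.2 j).choose (a j) : ℝ) * (((j.val + 1 : ℕ) : ℝ) / U.card) ^ a j *
          (1 - ((j.val + 1 : ℕ) : ℝ) / U.card) ^ (s.2 j - a j) =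
        (U.card : ℝ)⁻¹ * ∏ j : Fin k, binomialTerm (trials s.2 j)
          (((j.val + 1 : ℕ) : ℝ) / U.card) (successes s.2 (fun i => (a i : ℤ)) j) := by
      rw [← Finset.mul_prod_erase _ _ (Finset.mem_univ i), ← mul_assoc,
        ← Finset.mul_prod_erase Finset.univ (fun j => binomialTerm _ _ _) (Finset.mem_univ i),
        mul_binomial_eq _ _ _ _ hi.1 (Nat.succ_pos _), ← mul_assoc, trials, successes, if_pos hi,
        if_pos hi]
      congr 1
      refine Finset.prod_congr rfl fun j hj => ?_
      have hj' : ¬ IsLowestRipple s.2 j := fun h => (Finset.ne_of_mem_erase hj) (h.unique hi)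
      rw [trials, successes, if_neg hj', if_neg hj', binomialTerm, if_pos (by positivity),
        Int.toNat_natCast]
    rw [hz, hl, hA0, hAl, classCard_last, hG, Nat.choose_zero_right, pow_zero, sub_zero, one_pow]
    simp only [hr, hAr, classCard_rippleClass, hG]
    rw [transitionProb, binomialTerm, if_pos (by positivity), Int.toNat_natCast]
    linear_combination (graphWeight p G * prefixProb k G L * ((s.1.choose b : ℝ) *
      cloudExitProb n k p U.card ^ b * (1 - cloudExitProb n k p U.card) ^ (s.1 - b))) * hkey
  · intro G G' h
    rw [prefixProb_congr h, stateOf_congr h]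

/-! ### The initial state -/

theorem card_fiber_eq_multinomial {J T : Type*} [Fintype J] [DecidableEq J] [Fintype T]
    [DecidableEq T] (r : T → ℕ) (hr : ∑ h, r h = Fintype.card J) :
    (Finset.univ.filter fun τ : J → T =>
        ∀ h, (Finset.univ.filter fun j => τ j = h).card = r h).card =
      Nat.multinomial Finset.univ r := by
  -- compare the coefficients of two expansions of the same power of a sum of variables
  have hmon : ∀ a : T → ℕ, ∏ h, (MvPolynomial.X h : MvPolynomial T ℤ) ^ a h =
      MvPolynomial.monomial (Finsupp.equivFunOnFinite.symm a) 1 := by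
    intro a
    rw [MvPolynomial.monomial_eq, MvPolynomial.C_1, one_mul, Finsupp.prod_fintype _ _ (by simp)]
    rfl
  have h1 : (∑ h, (MvPolynomial.X h : MvPolynomial T ℤ)) ^ Fintype.card J =
      ∑ τ : J → T, MvPolynomial.monomial (Finsupp.equivFunOnFinite.symm fun h =>
        (Finset.univ.filter fun j => τ j = h).card) 1 := by
    have hp : (∑ h, (MvPolynomial.X h : MvPolynomial T ℤ)) ^ Fintype.card J =
        ∏ _j : J, ∑ h, (MvPolynomial.X h : MvPolynomial T ℤ) := by
      rw [Finset.prod_const, Finset.card_univ]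
    rw [hp, Fintype.prod_sum]
    refine Finset.sum_congr rfl fun τ _ => ?_
    rw [← hmon, ← Finset.prod_fiberwise_of_maps_to (g := τ) (t := Finset.univ) fun j _ =>
      Finset.mem_univ (τ j)]
    refine Finset.prod_congr rfl fun h _ => ?_
    rw [Finset.prod_congr rfl fun j hj => by rw [(Finset.mem_filter.mp hj).2], Finset.prod_const]
  rw [Finset.sum_pow_eq_sum_piAntidiag] at h1
  have h2 := congrArg (MvPolynomial.coeff (Finsupp.equivFunOnFinite.symm r)) h1
  rw [MvPolynomial.coeff_sum, MvPolynomial.coeff_sum, Finset.sum_eq_single r] at h2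
  · rw [hmon, ← map_natCast (MvPolynomial.C (σ := T) (R := ℤ)), MvPolynomial.coeff_C_mul,
      MvPolynomial.coeff_monomial, if_pos rfl, mul_one] at h2
    simp_rw [MvPolynomial.coeff_monomial, EmbeddingLike.apply_eq_iff_eq, funext_iff] at h2
    rw [← Finset.natCast_card_filter] at h2
    exact_mod_cast h2.symm
  · intro a _ ha
    rw [hmon, ← map_natCast (MvPolynomial.C (σ := T) (R := ℤ)), MvPolynomial.coeff_C_mul,
      MvPolynomial.coeff_monomial, if_neg (by simpa using ha), mul_zero]
  · intro h
    exact absurd (by simp [hr]) h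

/-- The numbers of independent samples in the classes follow the multinomial law. -/
theorem sum_pi_classCard_eq {J X T : Type*} [Fintype J] [DecidableEq J] [Fintype X] [Fintype T]
    [DecidableEq T] (w : X → ℝ) (cl : X → T) (r : T → ℕ) (hr : ∑ h, r h = Fintype.card J) :
    ∑ G : J → X, (∏ j, w (G j)) *
        (if ∀ h, (Finset.univ.filter fun j => cl (G j) = h).card = r h then 1 else 0) =
      (Nat.multinomial Finset.univ r : ℝ) * ∏ h, (∑ x with cl x = h, w x) ^ r h := by
  rw [← Finset.sum_fiberwise Finset.univ (fun (G : J → X) j => cl (G j)),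
    ← card_fiber_eq_multinomial (J := J) r hr, Finset.card_filter, Nat.cast_sum, Finset.sum_mul]
  refine Finset.sum_congr rfl fun τ _ => ?_
  have hfilter : (Finset.univ.filter fun G : J → X => (fun j => cl (G j)) = τ) =
      Fintype.piFinset fun j => Finset.univ.filter fun x => cl x = τ j := by
    ext G
    simp [Fintype.mem_piFinset, funext_iff]
  by_cases hτ : ∀ h, (Finset.univ.filter fun j => τ j = h).card = r h
  · rw [if_pos hτ, Nat.cast_one, one_mul]
    have e : ∏ h, (∑ x with cl x = h, w x) ^ r h = ∏ j, ∑ x with cl x = τ j, w x := by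
      rw [← Finset.prod_fiberwise_of_maps_to (g := τ) (t := Finset.univ) fun j _ =>
        Finset.mem_univ (τ j)]
      refine Finset.prod_congr rfl fun h _ => ?_
      rw [← hτ h, ← Finset.prod_const]
      exact Finset.prod_congr rfl fun j hj => by rw [(Finset.mem_filter.mp hj).2]
    rw [e, Finset.prod_univ_sum, hfilter]
    refine Finset.sum_congr rfl fun G hG => ?_
    rw [if_pos, mul_one]
    intro h
    rw [← hτ h]
    simp only [fun j => (Finset.mem_filter.mp (Fintype.mem_piFinset.mp hG j)).2]
  · rw [if_neg hτ, Nat.cast_zero, zero_mul]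
    refine Finset.sum_eq_zero fun G hG => ?_
    rw [if_neg, mul_zero]
    intro h
    refine hτ fun a => ?_
    rw [← h a, ← (Finset.mem_filter.mp hG).2]

theorem unresolved_nil : unresolved ([] : List (Fin n)) = Finset.univ := by
  simp [unresolved]

theorem sum_classCard (G : Graph n m) (U : Finset (Fin n)) : ∑ h, classCard k G U h = m := by
  unfold classCard
  rw [← Finset.card_eq_sum_card_fiberwise fun j _ => Finset.mem_coe.mpr (Finset.mem_univ _)]
  simp

theorem sum_classCard_eq (G : Graph n m) (U : Finset (Fin n)) :
    classCard k G U 0 + (∑ i, (stateOf k G U).2 i + (stateOf k G U).1) = m := by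
  refine Eq.trans ?_ (sum_classCard (k := k) G U)
  rw [Fin.sum_univ_succ, Fin.sum_univ_castSucc, Fin.succ_last, classCard_last]
  simp only [classCard_rippleClass]

/-- The law of the initial state: the slots are independent, and `slotClass` sorts them into the
slots of degree `0`, the ripples and the cloud. -/
theorem sum_graphWeight_stateOf_univ (p : ℝ) (s : State k) :
    ∑ G : Graph n m, graphWeight p G * (if stateOf k G Finset.univ = s then 1 else 0) =
      initialProb n m k p s := by
  rw [initialProb]
  split_ifs with hle
  swap
  · refine Finset.sum_eq_zero fun G _ => ?_
    rw [if_neg, mul_zero]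
    rintro rfl
    have := sum_classCard_eq (k := k) G Finset.univ
    omega
  let r : Fin (k + 2) → ℕ := Fin.cons (m - s.1 - ∑ i, s.2 i) (Fin.snoc s.2 s.1 : Fin (k + 1) → ℕ)
  have hr0 : r 0 = m - s.1 - ∑ i, s.2 i := rfl
  have hrr : ∀ i, r (rippleClass i) = s.2 i := by
    intro i
    simp only [r, rippleClass, Fin.cons_succ, Fin.snoc_castSucc]
  have hrl : r (Fin.last (k + 1)) = s.1 := by
    rw [← Fin.succ_last]
    simp only [r, Fin.cons_succ, Fin.snoc_last]
  have hsum : ∑ h, r h = m := by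
    rw [Fin.sum_univ_succ, Fin.sum_univ_castSucc, Fin.succ_last, hrl, hr0]
    simp only [hrr]
    omega
  have hiff : ∀ G : Graph n m, stateOf k G Finset.univ = s ↔
      ∀ h, (Finset.univ.filter fun j => slotClass k Finset.univ (G j) = h).card = r h := by
    intro G
    change _ ↔ ∀ h, classCard k G Finset.univ h = r h
    constructor
    · rintro hG h
      have := sum_classCard_eq (k := k) G Finset.univ
      rw [hG] at this
      refine Fin.cases ?_ (fun h => Fin.lastCases ?_ (fun i => ?_) h) h
      · omega
      · rw [Fin.succ_last, hrl, classCard_last, hG]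
      · rw [hrr, classCard_rippleClass, hG]
    · intro h
      refine Prod.ext ?_ (funext fun i => ?_)
      · rw [← classCard_last, h, hrl]
      · rw [← classCard_rippleClass, h, hrr]
  have hdeg : ∀ h, ∑ x : Fin n → Bool with slotDeg Finset.univ x = h, slotWeight p x =
      slotDegreeProb n p h := by
    intro h
    have := sum_slotWeight_deg_eq p (Finset.univ : Finset (Fin n)) h
    simp only [mul_ite, mul_one, mul_zero, ← Finset.sum_filter] at this
    rw [this, slotDegreeProb, Finset.card_univ, Fintype.card_fin, mul_assoc]
  have hcl0 : ∑ x : Fin n → Bool with slotClass k Finset.univ x = 0, slotWeight p x =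
      slotDegreeProb n p 0 := by
    rw [← hdeg]
    congr 1
    refine Finset.filter_congr fun x _ => ?_
    rw [Fin.ext_iff]
    change min _ _ = 0 ↔ _
    omega
  have hclr : ∀ i : Fin k, ∑ x : Fin n → Bool with slotClass k Finset.univ x = rippleClass i,
      slotWeight p x = slotDegreeProb n p (i.val + 1) := by
    intro i
    rw [← hdeg]
    simp only [slotClass_eq_rippleClass_iff]
  have hcll : ∑ x : Fin n → Bool with slotClass k Finset.univ x = Fin.last (k + 1),
      slotWeight p x = 1 - ∑ h ∈ Finset.Icc 0 k, slotDegreeProb n p h := by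
    have := sum_slotWeight_lt_deg (k := k) p (Finset.univ : Finset (Fin n))
    simp only [mul_ite, mul_one, mul_zero, ← Finset.sum_filter] at this
    simp only [slotClass_eq_last_iff]
    rw [this]
    simp only [slotDegreeProb, Finset.card_univ, Fintype.card_fin, mul_assoc]
  refine (Finset.sum_congr rfl fun G _ => ?_).trans ((sum_pi_classCard_eq (J := Fin m)
    (slotWeight p) (slotClass k Finset.univ) r (by simpa using hsum)).trans ?_)
  · by_cases h : stateOf k G Finset.univ = s
    · rw [if_pos h, if_pos ((hiff G).mp h)]
      rfl
    · rw [if_neg h, if_neg (mt (hiff G).mpr h), mul_zero, mul_zero]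
  rw [Fin.prod_univ_succ, Fin.prod_univ_castSucc, Fin.succ_last, hcl0, hcll, hrl, hr0]
  simp only [hclr, hrr]
  have hspec := Nat.multinomial_spec Finset.univ r
  rw [hsum, Fin.prod_univ_succ, Fin.prod_univ_castSucc, Fin.succ_last, hrl, hr0] at hspec
  simp only [hrr] at hspec
  have hspec' : (m.factorial : ℝ) / ((s.1.factorial : ℝ) * (∏ i, ((s.2 i).factorial : ℝ)) *
      ((m - s.1 - ∑ i, s.2 i).factorial : ℝ)) = (Nat.multinomial Finset.univ r : ℝ) := by
    have hne : (s.1.factorial : ℝ) * (∏ i, ((s.2 i).factorial : ℝ)) *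
        ((m - s.1 - ∑ i, s.2 i).factorial : ℝ) ≠ 0 := by
      refine mul_ne_zero (mul_ne_zero ?_ (Finset.prod_ne_zero_iff.mpr fun i _ => ?_)) ?_ <;>
        exact_mod_cast Nat.factorial_ne_zero _
    rw [div_eq_iff hne, ← hspec]
    push_cast
    ring
  rw [hspec']
  ring

/-! ### The recursion for the state probabilities -/

/-- The probability that the first users to be resolved are those in `L`, in this order, and that
the state is then `s`. -/
noncomputable def prefixStateProb (m : ℕ) (p : ℝ) (L : List (Fin n)) (s : State k) : ℝ :=
  ∑ G : Graph n m, graphWeight p G *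
    (prefixProb k G L * if stateOf k G (unresolved L) = s then 1 else 0)

theorem stateOf_mem_states (G : Graph n m) (U : Finset (Fin n)) :
    stateOf k G U ∈ states m k := by
  have hle : ∀ S : Finset (Fin m), S.card ∈ Finset.range (m + 1) := fun S =>
    Finset.mem_range.mpr (Nat.lt_succ_of_le (by simpa using S.card_le_univ))
  exact Finset.mem_product.mpr ⟨hle (cloud k G U),
    Fintype.mem_piFinset.mpr fun i => hle (ripple G U (i.val + 1))⟩

theorem prefixStateProb_append {p : ℝ} (h0 : 0 ≤ p) (h1 : p ≤ 1) {L : List (Fin n)} {v : Fin n}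
    (hv : v ∈ unresolved L) (s' : State k) :
    prefixStateProb m p (L ++ [v]) s' = ((unresolved L).card : ℝ)⁻¹ *
      ∑ s ∈ (states m k).filter (fun s => 0 < ∑ i, s.2 i), prefixStateProb m p L s *
        transitionProb n k p (unresolved L).card s ((s.1 : ℤ) - s'.1) (leaving s s') := by
  have hsplit : ∀ G : Graph n m, prefixProb k G (L ++ [v]) *
      (if stateOf k G (unresolved (L ++ [v])) = s' then 1 else 0) =
      ∑ s ∈ (states m k).filter (fun s => 0 < ∑ i, s.2 i), prefixProb k G (L ++ [v]) *
        if stateOf k G (unresolved L) = s ∧ stateOf k G (unresolved (L ++ [v])) = s'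
          then 1 else 0 := by
    intro G
    by_cases hpos : 0 < ∑ i, (stateOf k G (unresolved L)).2 i
    · rw [Finset.sum_eq_single (stateOf k G (unresolved L))]
      · simp
      · intro s _ hs
        rw [if_neg fun h => hs h.1.symm, mul_zero]
      · intro h
        exact absurd (Finset.mem_filter.mpr ⟨stateOf_mem_states G _, hpos⟩) h
    · have hz : prefixProb k G (L ++ [v]) = 0 := by
        rw [prefixProb_append, resolveProb, lowest_eq_empty_iff_stateOf.mpr (by omega),
          Finset.sum_empty, mul_zero]
      simp [hz]
  rw [prefixStateProb]
  simp_rw [hsplit, Finset.mul_sum]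
  rw [Finset.sum_comm]
  refine Finset.sum_congr rfl fun s hs => ?_
  rw [sum_prefixProb_append h0 h1 hv (Finset.mem_filter.mp hs).2 (by ring)
    (inflow_leaving s s'), prefixStateProb, mul_assoc]

theorem sum_prefixStateProb_eq {p : ℝ} (h0 : 0 ≤ p) (h1 : p ≤ 1) {t : ℕ} (ht : t ≤ n)
    (s : State k) :
    ∑ L ∈ orders n t, prefixStateProb m p L s = stateProbAux n m k p t s := by
  induction t generalizing s with
  | zero =>
    rw [orders, Finset.sum_singleton, prefixStateProb, stateProbAux,
      ← sum_graphWeight_stateOf_univ]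
    simp only [unresolved_nil, prefixProb_nil, one_mul]
  | succ t ih =>
    rw [sum_orders_succ, stateProbAux]
    simp_rw [← ih (by omega), Finset.sum_mul]
    rw [Finset.sum_comm]
    refine Finset.sum_congr rfl fun L hL => ?_
    obtain ⟨hnd, hlen⟩ := mem_orders.mp hL
    have hcard : (unresolved L).card = n - t := by rw [card_unresolved hnd, hlen]
    have hne : ((n - t : ℕ) : ℝ) ≠ 0 := by
      have : n - t ≠ 0 := by omega
      exact_mod_cast this
    rw [Finset.sum_congr rfl fun v hv => prefixStateProb_append h0 h1 hv s, Finset.sum_const,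
      nsmul_eq_mul, hcard, ← mul_assoc, mul_inv_cancel₀ hne, one_mul]

/-- By symmetry, a given user is among the `n - t` unresolved ones with probability `(n - t) / n`,
independently of the state. -/
theorem sum_prefixStateProb_notMem {p : ℝ} (h0 : 0 ≤ p) (h1 : p ≤ 1) (v : Fin n) {t : ℕ}
    (ht : t ≤ n) (s : State k) :
    ∑ L ∈ orders n t with v ∉ L, prefixStateProb m p L s =
      ((n - t : ℕ) : ℝ) / n * stateProbAux n m k p t s := by
  have hn : (n : ℝ) ≠ 0 := by
    have : n ≠ 0 := by have := v.isLt; omega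
    exact_mod_cast this
  induction t generalizing s with
  | zero =>
    have hfil : (orders n 0).filter (fun L => v ∉ L) = orders n 0 := by
      simp [orders, Finset.filter_singleton]
    rw [← sum_prefixStateProb_eq h0 h1 ht, Nat.sub_zero, div_self hn, one_mul, hfil]
  | succ t ih =>
    rw [Finset.sum_filter, sum_orders_succ, stateProbAux, Finset.mul_sum]
    have hne : ((n - t : ℕ) : ℝ) ≠ 0 := by
      have : n - t ≠ 0 := by omega
      exact_mod_cast this
    have hstep : ∀ L ∈ orders n t, ∑ x ∈ unresolved L,
        (if v ∉ L ++ [x] then prefixStateProb m p (L ++ [x]) s else 0) =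
        ∑ s₀ ∈ (states m k).filter (fun s => 0 < ∑ i, s.2 i),
          ((n - (t + 1) : ℕ) : ℝ) / ((n - t : ℕ) : ℝ) *
          (if v ∉ L then prefixStateProb m p L s₀ else 0) *
          transitionProb n k p (n - t) s₀ ((s₀.1 : ℤ) - s.1) (leaving s₀ s) := by
      intro L hL
      obtain ⟨hnd, hlen⟩ := mem_orders.mp hL
      have hcard : (unresolved L).card = n - t := by rw [card_unresolved hnd, hlen]
      by_cases hvL : v ∈ L
      · simp [hvL]
      have hcard' : ((unresolved L).erase v).card = n - (t + 1) := by
        rw [Finset.card_erase_of_mem (mem_unresolved.mpr hvL), hcard, Nat.sub_sub]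
      have hfil : ∀ x, v ∉ L ++ [x] ↔ x ≠ v := by
        intro x; simp [hvL, eq_comm]
      simp only [hfil]
      rw [← Finset.sum_filter, Finset.filter_ne',
        Finset.sum_congr rfl fun x hx =>
          prefixStateProb_append h0 h1 (Finset.mem_of_mem_erase hx) s,
        Finset.sum_const, nsmul_eq_mul, hcard', hcard, ← mul_assoc, Finset.mul_sum]
      exact Finset.sum_congr rfl fun s₀ _ => by rw [if_pos hvL]; ring
    rw [Finset.sum_congr rfl hstep, Finset.sum_comm]
    refine Finset.sum_congr rfl fun s₀ _ => ?_
    rw [← Finset.sum_mul, ← Finset.mul_sum, ← Finset.sum_filter, ih (by omega)]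
    field_simp

/-! ### The law of the state, the packet error rate and the throughput -/

theorem stateAt_eq_some_iff {t : ℕ} (ht : t ≤ n) (ω : Outcome n m) (s : State k) :
    stateAt k (n - t) ω = some s ↔
      t ≤ ω.resolved.length ∧ stateOf k ω.graph (unresolved (ω.resolved.take t)) = s := by
  rw [stateAt, show n - (n - t) = t by omega]
  by_cases h : t ≤ ω.resolved.length <;> simp [h]

theorem runLaw_real_stateAt (p : unitInterval) {t : ℕ} (ht : t ≤ n) (s : State k) :
    (runLaw n m k p).real {ω | stateAt k (n - t) ω = some s} =
      ∑ L ∈ orders n t, prefixStateProb m p L s := by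
  simp_rw [stateAt_eq_some_iff ht]
  exact runLaw_real_prefix p ht fun G L => stateOf k G (unresolved L) = s

theorem runLaw_real_stateAt_inter (p : unitInterval) {t : ℕ} (ht : t < n) {s s' : State k}
    (hs : 0 < ∑ i, s.2 i) {b : ℤ} {a : Fin k → ℤ} (hb : (s'.1 : ℤ) = s.1 - b)
    (ha : ∀ i, (s'.2 i : ℤ) = s.2 i + (inflow b a i - a i)) :
    (runLaw n m k p).real ({ω | stateAt k (n - t) ω = some s} ∩
        {ω | stateAt k (n - (t + 1)) ω = some s'}) =
      (runLaw n m k p).real {ω | stateAt k (n - t) ω = some s} *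
        transitionProb n k p (n - t) s b a := by
  have hset : {ω : Outcome n m | stateAt k (n - t) ω = some s} ∩
      {ω | stateAt k (n - (t + 1)) ω = some s'} =
      {ω | t + 1 ≤ ω.resolved.length ∧
        (stateOf k ω.graph (unresolved ((ω.resolved.take (t + 1)).take t)) = s ∧
          stateOf k ω.graph (unresolved (ω.resolved.take (t + 1))) = s')} := by
    ext ω
    change (stateAt k (n - t) ω = some s ∧ stateAt k (n - (t + 1)) ω = some s') ↔ _ ∧ _ ∧ _
    rw [stateAt_eq_some_iff ht.le, stateAt_eq_some_iff (Nat.succ_le_of_lt ht), List.take_take,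
      min_eq_left (by omega)]
    constructor
    · rintro ⟨⟨_, h2⟩, h3, h4⟩; exact ⟨h3, h2, h4⟩
    · rintro ⟨h3, h2, h4⟩; exact ⟨⟨by omega, h2⟩, h3, h4⟩
  rw [hset, runLaw_real_prefix p (Nat.succ_le_of_lt ht) fun G L =>
    stateOf k G (unresolved (L.take t)) = s ∧ stateOf k G (unresolved L) = s',
    runLaw_real_stateAt p ht.le, sum_orders_succ, Finset.sum_mul]
  refine Finset.sum_congr rfl fun L hL => ?_
  obtain ⟨hnd, hlen⟩ := mem_orders.mp hL
  have hcard : (unresolved L).card = n - t := by rw [card_unresolved hnd, hlen]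
  have hne : ((n - t : ℕ) : ℝ) ≠ 0 := by
    have : n - t ≠ 0 := by omega
    exact_mod_cast this
  have htake : ∀ x, (L ++ [x]).take t = L := fun x => by
    rw [← hlen, List.take_left' rfl]
  simp only [htake]
  rw [Finset.sum_congr rfl fun v hv =>
    sum_prefixProb_append p.2.1 p.2.2 hv hs hb ha, Finset.sum_const, nsmul_eq_mul, hcard,
    ← mul_assoc, ← mul_assoc, mul_inv_cancel₀ hne, one_mul, prefixStateProb]

theorem packetErrorRate_eq (p : unitInterval) (v : Fin n) :
    packetErrorRate n m k p v = packetErrorFormula n m k p := by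
  rw [packetErrorRate, runLaw_real_final p fun L => v ∉ L, Finset.sum_range_succ]
  -- after `n` steps, no user is left
  have hlast : (orders n n).filter (fun L => v ∉ L) = ∅ := by
    rw [Finset.filter_eq_empty_iff]
    intro L hL hv
    obtain ⟨hnd, hlen⟩ := mem_orders.mp hL
    have h := card_unresolved hnd
    rw [hlen, Nat.sub_self, Finset.card_eq_zero] at h
    exact absurd (mem_unresolved.mpr hv) (by simp [h])
  rw [hlast, Finset.sum_empty, add_zero, packetErrorFormula]
  refine Finset.sum_nbij' (fun t => n - t) (fun u => n - u) ?_ ?_ ?_ ?_ ?_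
  · intro t ht
    rw [Finset.mem_range] at ht
    rw [Finset.mem_Icc]
    omega
  · intro u hu
    rw [Finset.mem_Icc] at hu
    rw [Finset.mem_range]
    omega
  · intro t ht
    rw [Finset.mem_range] at ht
    omega
  · intro u hu
    rw [Finset.mem_Icc] at hu
    omega
  intro t ht
  rw [Finset.mem_range] at ht
  have hempty : ∀ (G : Graph n m) (U : Finset (Fin n)), (if lowest k G U = ∅ then (1 : ℝ) else 0) =
      ∑ c ∈ Finset.range (m + 1), if stateOf k G U = (c, fun _ => 0) then 1 else 0 := by
    intro G U
    have hiff : lowest k G U = ∅ ↔ (stateOf k G U).2 = fun _ => 0 := by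
      rw [lowest_eq_empty_iff_stateOf, Finset.sum_eq_zero_iff, funext_iff]
      simp
    by_cases h : lowest k G U = ∅
    · rw [if_pos h, Finset.sum_eq_single (stateOf k G U).1, if_pos]
      · exact Prod.ext rfl (hiff.mp h)
      · intro c _ hc
        rw [if_neg]
        intro h'
        exact hc (congrArg Prod.fst h').symm
      · intro h'
        exact absurd (Finset.mem_product.mp (stateOf_mem_states G U)).1 h'
    · rw [if_neg h, Finset.sum_eq_zero]
      intro c _
      rw [if_neg]
      intro h'
      exact h (hiff.mpr (congrArg Prod.snd h'))
  simp only [hempty, Finset.mul_sum]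
  have hcomm : ∀ L : List (Fin n), ∑ G : Graph n m, ∑ c ∈ Finset.range (m + 1),
      graphWeight (p : ℝ) G * (prefixProb k G L *
        if stateOf k G (unresolved L) = (c, fun _ => 0) then 1 else 0) =
      ∑ c ∈ Finset.range (m + 1), prefixStateProb m p L ((c, fun _ => 0) : State k) :=
    fun L => Finset.sum_comm
  simp only [hcomm]
  rw [Finset.sum_comm]
  refine Finset.sum_congr rfl fun c _ => ?_
  rw [sum_prefixStateProb_notMem p.2.1 p.2.2 v ht.le, stateProb, show n - (n - t) = t by omega]

instance (p : unitInterval) : IsProbabilityMeasure (runLaw n m k p) := by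
  unfold runLaw
  infer_instance

theorem integral_card_resolved (p : unitInterval) :
    ∫ ω, (ω.resolved.toFinset.card : ℝ) ∂(runLaw n m k p) =
      n * (1 - packetErrorFormula n m k p) := by
  have hcard : ∀ ω : Outcome n m, (ω.resolved.toFinset.card : ℝ) =
      ∑ v : Fin n, {ω : Outcome n m | v ∈ ω.resolved}.indicator (fun _ => (1 : ℝ)) ω := by
    intro ω
    have : ω.resolved.toFinset = Finset.univ.filter fun v => v ∈ ω.resolved := by ext; simp
    rw [this, Finset.natCast_card_filter]
    exact Finset.sum_congr rfl fun v _ => by simp [Set.indicator_apply]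
  have hmeas : ∀ E : Set (Outcome n m), MeasurableSet E := fun _ => trivial
  simp_rw [hcard]
  rw [integral_finsetSum _ fun v _ => (integrable_const (1 : ℝ)).indicator (hmeas _)]
  have hv : ∀ v : Fin n, ∫ ω, {ω : Outcome n m | v ∈ ω.resolved}.indicator (fun _ => (1 : ℝ)) ω
      ∂(runLaw n m k p) = 1 - packetErrorFormula n m k p := by
    intro v
    rw [integral_indicator_const _ (hmeas _), smul_eq_mul, mul_one, ← packetErrorRate_eq p v,
      packetErrorRate, ← probReal_compl_eq_one_sub (hmeas _)]
    congr 1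
    ext ω
    simp
  rw [Finset.sum_congr rfl fun v _ => hv v, Finset.sum_const, Finset.card_univ, Fintype.card_fin,
    nsmul_eq_mul]

end FramelessAloha

theorem theorem1 (n m k : ℕ) (hn : 0 < n) (hm : 0 < m) (hk : 0 < k)
    (β : ℝ) (p : unitInterval) (hp : (p : ℝ) = β / n) :
    -- the transition law, given a state with a non-empty ripple
    (∀ u : ℕ, 1 ≤ u → u ≤ n → ∀ s : FramelessAloha.State k, 0 < ∑ i, s.2 i →
      FramelessAloha.runLaw n m k p {ω | FramelessAloha.stateAt k u ω = some s} ≠ 0 →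
      ∀ (b : ℤ) (a : Fin k → ℤ) (s' : FramelessAloha.State k),
        (s'.1 : ℤ) = s.1 - b →
        (∀ i, (s'.2 i : ℤ) = s.2 i + (FramelessAloha.inflow b a i - a i)) →
        (cond (FramelessAloha.runLaw n m k p)
            {ω | FramelessAloha.stateAt k u ω = some s}).real
            {ω | FramelessAloha.stateAt k (u - 1) ω = some s'} =
          FramelessAloha.transitionProb n k (β / n) u s b a) ∧
    -- the initial state
    (∀ s : FramelessAloha.State k,
      (FramelessAloha.runLaw n m k p).real {ω | FramelessAloha.stateAt k n ω = some s} =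
        FramelessAloha.initialProb n m k (β / n) s) ∧
    -- the state probabilities at every stage
    (∀ u : ℕ, u ≤ n → ∀ s : FramelessAloha.State k,
      (FramelessAloha.runLaw n m k p).real {ω | FramelessAloha.stateAt k u ω = some s} =
        FramelessAloha.stateProb n m k (β / n) u s) ∧
    -- the packet error rate, the same for every user
    (∀ v : Fin n, FramelessAloha.packetErrorRate n m k p v =
      FramelessAloha.packetErrorFormula n m k (β / n)) ∧
    -- the expected throughput
    FramelessAloha.throughput n m k p =
      (n : ℝ) * (1 - FramelessAloha.packetErrorFormula n m k (β / n)) / ((k : ℝ) * (m : ℝ)) := by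
  rw [← hp]
  have hstate : ∀ u : ℕ, u ≤ n → ∀ s : FramelessAloha.State k,
      (FramelessAloha.runLaw n m k p).real {ω | FramelessAloha.stateAt k u ω = some s} =
        FramelessAloha.stateProb n m k p u s := by
    intro u hu s
    obtain ⟨t, ht, rfl⟩ : ∃ t, t ≤ n ∧ u = n - t := ⟨n - u, by omega, by omega⟩
    rw [FramelessAloha.runLaw_real_stateAt p ht,
      FramelessAloha.sum_prefixStateProb_eq p.2.1 p.2.2 ht, FramelessAloha.stateProb,
      show n - (n - t) = t by omega]
  refine ⟨?_, ?_, hstate, FramelessAloha.packetErrorRate_eq p, ?_⟩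
  · intro u hu1 hun s hs hpos b a s' hb ha
    obtain ⟨t, ht, rfl⟩ : ∃ t, t < n ∧ u = n - t := ⟨n - u, by omega, by omega⟩
    have hpos' : (FramelessAloha.runLaw n m k p).real
        {ω | FramelessAloha.stateAt k (n - t) ω = some s} ≠ 0 := by
      rwa [ne_eq, measureReal_eq_zero_iff]
    rw [Nat.sub_sub, Measure.real, cond_apply MeasurableSpace.measurableSet_top,
      ENNReal.toReal_mul, ENNReal.toReal_inv, ← Measure.real, ← Measure.real,
      FramelessAloha.runLaw_real_stateAt_inter p ht hs hb ha, inv_mul_cancel_left₀ hpos']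
  · intro s
    rw [hstate n le_rfl s, FramelessAloha.stateProb, Nat.sub_self]
    rfl
  · rw [FramelessAloha.throughput, FramelessAloha.integral_card_resolved]
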